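/- Let $K$ be a field of characteristic $0$ (for instance $K=\mathbb{C}$). For a Lie algebra $L$ put $L^1=L$ and $L^{k+1}=[L,L^k]$. A finite-dimensional Lie algebra $L$ is nilpotent of nilindex $t\ge 1$ if $L^t\neq 0$ and $L^{t+1}=0$, and it has type $2$ if $\dim L-\dim L^2=2$. Let $\mathfrak{FL}_2$ be the free Lie algebra over $K$ on two generators and let $\mathfrak n_{2,t}=\mathfrak{FL}_2/\mathfrak{FL}_2^{t+1}$ be the free nilpotent Lie algebra. Let $v_0,v_1$ be the images of the generators in $\mathfrak n_{2,t}$ and put $$w_0=[v_0,v_1],\quad z_i=[v_i,w_0]\ (i=0,1),\quad x_0=[v_0,z_0],\quad x_1=2[v_0,z_1],\quad x_2=[v_1,z_1].$$ Then $\mathfrak n_{2,3}^3=\mathrm{span}\langle z_0,z_1\rangle$ and $\mathfrak n_{2,4}^4=\mathrm{span}\langle x_0,x_1,x_2\rangle$. Up to isomorphism, the nilpotent Lie algebras over $K$ of type $2$ and nilindex $t\le 4$ are exactly the following (repetitions up to isomorphism are allowed in the list): a) $\mathfrak n_{2,t}$ for $t=1,2,3,4$; b) $\mathfrak n_{2,3}/I$,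 where $I$ is any $1$-dimensional subspace of $\mathfrak n_{2,3}^3$; c) $\mathfrak n_{2,4}/I$, where $I$ is one of the following: (i) any $1$- or $2$-dimensional subspace of $\mathfrak n_{2,4}^4$; (ii) $I=\mathrm{span}\langle z_1+\alpha x_0,\ x_1,\ x_2\rangle$ with $\alpha\in K$; (iii) $I=\mathrm{span}\langle z_0+\alpha z_1+\beta x_2,\ 2x_0+\alpha x_1,\ x_1+2\alpha x_2\rangle$ with $\alpha,\beta\in K$. All the subspaces $I$ in b) and c) are ideals, so the quotients are Lie algebras. Moreover, among the algebras in this list, those that admit a nontrivial Levi extension are exactly the ones in a). Here a nontrivial Levi extension of $\mathfrak n$ is a finite-dimensional Lie algebra $\mathfrak g=\mathfrak s\oplus\mathfrak r$ (direct sum of vector spaces) whose solvable radical $\mathfrak r$ is isomorphic to $\mathfrak n$, where $\mathfrak s$ is a semisimple subalgebra with $[\mathfrak s,\mathfrak r]\neq 0$. -/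

import Mathlib

universe u v

/-- The term `L^k` (`k ≥ 1`) of the lower central series of a Lie algebra:
`L^1 = L`, `L^(k+1) = [L, L^k]`.  (Mathlib's series is indexed from `0`; only `k ≥ 1` is used.) -/
abbrev lowerCentralPower (K : Type u) [Field K] (L : Type v) [LieRing L] [LieAlgebra K L] (k : ℕ) :
    LieIdeal K L :=
  LieModule.lowerCentralSeries K L L (k - 1)

/-- `L` is nilpotent of nilindex `t` (`t ≥ 1`): `L^t ≠ 0` and `L^(t+1) = 0`. -/
def IsNilpotentOfNilindex (K : Type u) [Field K] (L : Type v) [LieRing L] [LieAlgebra K L] (t : ℕ) :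
    Prop :=
  1 ≤ t ∧ lowerCentralPower K L t ≠ ⊥ ∧ lowerCentralPower K L (t + 1) = ⊥

/-- `L` is finite-dimensional of type `d`: `dim L - dim L^2 = d`. -/
def HasLieType (K : Type u) [Field K] (L : Type v) [LieRing L] [LieAlgebra K L] (d : ℕ) : Prop :=
  FiniteDimensional K L ∧
    Module.finrank K L = Module.finrank K (lowerCentralPower K L 2) + d

/-- The free nilpotent Lie algebra `𝔫_{2,t} = FL₂ / FL₂^(t+1)`. -/
abbrev FreeNilpotentTwo (K : Type u) [Field K] (t : ℕ) : Type u :=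
  FreeLieAlgebra K (Fin 2) ⧸ lowerCentralPower K (FreeLieAlgebra K (Fin 2)) (t + 1)

namespace FreeNilpotentTwo

/-- The images `v₀`, `v₁` of the two free generators. -/
noncomputable def vv (K : Type u) [Field K] (t : ℕ) (i : Fin 2) : FreeNilpotentTwo K t :=
  LieSubmodule.Quotient.mk (FreeLieAlgebra.of K i)

/-- `w₀ = [v₀, v₁]`. -/
noncomputable def ww (K : Type u) [Field K] (t : ℕ) : FreeNilpotentTwo K t :=
  ⁅vv K t 0, vv K t 1⁆

/-- `z₀ = [v₀, w₀]` and `z₁ = [v₁, w₀]`. -/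
noncomputable def zz (K : Type u) [Field K] (t : ℕ) (i : Fin 2) : FreeNilpotentTwo K t :=
  ⁅vv K t i, ww K t⁆

/-- `x₀ = [v₀, z₀]`. -/
noncomputable def xx₀ (K : Type u) [Field K] (t : ℕ) : FreeNilpotentTwo K t :=
  ⁅vv K t 0, zz K t 0⁆

/-- `x₁ = 2 [v₀, z₁]`, which is also `2 [v₁, z₀]`. -/
noncomputable def xx₁ (K : Type u) [Field K] (t : ℕ) : FreeNilpotentTwo K t :=
  (2 : K) • ⁅vv K t 0, zz K t 1⁆

/-- `x₂ = [v₁, z₁]`. -/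
noncomputable def xx₂ (K : Type u) [Field K] (t : ℕ) : FreeNilpotentTwo K t :=
  ⁅vv K t 1, zz K t 1⁆

/-- The subspaces of `𝔫_{2,3}` in the list: the lines in `𝔫_{2,3}^3`. -/
def IsListedThree (K : Type u) [Field K] (I : Submodule K (FreeNilpotentTwo K 3)) : Prop :=
  I ≤ (lowerCentralPower K (FreeNilpotentTwo K 3) 3).toSubmodule ∧ Module.finrank K I = 1

/-- The subspaces of `𝔫_{2,4}` in the list: the lines and planes in `𝔫_{2,4}^4`, and
the two parametrized families. -/
def IsListedFour (K : Type u) [Field K] (I : Submodule K (FreeNilpotentTwo K 4)) : Prop :=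
  (I ≤ (lowerCentralPower K (FreeNilpotentTwo K 4) 4).toSubmodule ∧
      (Module.finrank K I = 1 ∨ Module.finrank K I = 2)) ∨
  (∃ α : K, I = Submodule.span K {zz K 4 1 + α • xx₀ K 4, xx₁ K 4, xx₂ K 4}) ∨
  (∃ α β : K, I = Submodule.span K
      {zz K 4 0 + α • zz K 4 1 + β • xx₂ K 4,
        (2 : K) • xx₀ K 4 + α • xx₁ K 4,
        xx₁ K 4 + (2 * α) • xx₂ K 4})

end FreeNilpotentTwo

/-- `N` admits a nontrivial Levi extension: there is a finite-dimensional Lie algebra `g = s ⊕ r`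
whose solvable radical `r` is isomorphic to `N`, with `s` a Levi subalgebra, such that `[s, r] ≠ 0`
(so that `g` is not the direct sum of the ideals `s` and `r`). -/
def AdmitsNontrivialLeviExtension (K : Type u) [Field K] (N : Type u) [LieRing N]
    [LieAlgebra K N] : Prop :=
  ∃ (g : Type u) (_ : LieRing g) (_ : LieAlgebra K g),
    FiniteDimensional K g ∧
    Nonempty (LieAlgebra.radical K g ≃ₗ⁅K⁆ N) ∧
    ∃ s : LieSubalgebra K g,
      LieAlgebra.HasTrivialRadical K s ∧
      IsCompl s.toSubmodule (LieAlgebra.radical K g).toSubmodule ∧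
      ∃ x ∈ s, ∃ y ∈ LieAlgebra.radical K g, ⁅x, y⁆ ≠ 0

/-! Lifting a basis of `L/L^2` shows that a nilpotent `L` of type 2 and nilindex `t` is `𝔫/J` with
`𝔫 = 𝔫_{2,t}` (`exists_surjective_of_hasLieType`). Type 2 means `J ⊆ 𝔫^2`; nilindex `t` means `𝔫^t ⊄
J`. So the classification is one of ideals with these two properties.

The main tool is `lcSeries_le_of_le_sup`: an ideal of a nilpotent algebra that contains a term of
the lower central series modulo the next one contains that term. Hence `J` cannot cover a whole
layer `𝔫^k/𝔫^(k+1)` with `k ≤ t`. The second layer is the line of `w₀`, so `J ⊆ 𝔫^3` when `t ≥ 2`.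
This settles `t ≤ 3`. For `t = 4`, either `J ⊆ 𝔫^4`, or `J` has an element with leading part `a z₀ +
b z₁ ≠ 0`. Its brackets with `v₀`, `v₁` span a plane in `𝔫^4`, which must be all of `J ∩ 𝔫^4`, and
`J` covers only a line of `𝔫^3/𝔫^4`. Normalising `a = 0` or `a ≠ 0` gives the two families
(`eq_bot_or_isListedFour`). Independence of the basic brackets comes from an explicit 8-dimensional
model, `CoordFreeNilpotent`.

For Levi extensions, `𝔰𝔩₂` acts on the span of the generators, hence by derivations on the free Lie
algebra and on `𝔫`; the semidirect product is the extension. Conversely a Levi subalgebra is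
perfect, so its image in `𝔤𝔩(N/N^2)` is a perfect space of `2 × 2` matrices: zero or `𝔰𝔩₂`
(`eq_bot_or_mem_of_le_span_commutators`). If zero, perfectness and nilpotency make the whole action
zero. If `𝔰𝔩₂`, each graded layer of `J` is `𝔰𝔩₂`-stable; the layers of `𝔫` in degrees 2, 3, 4 are
irreducible of dimensions 1, 2, 3, so a nonzero layer of `J` would be full, which is excluded. Hence
`J = 0` (`ker_le_lcSeries_of_action`). -/

/-- The lower central series of a Lie algebra, indexed from `0`. -/
abbrev lcSeries (K : Type u) [Field K] (L : Type v) [LieRing L] [LieAlgebra K L] (k : ℕ) :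
    LieIdeal K L :=
  LieModule.lowerCentralSeries K L L k

/-! ### Lower central series: generation, layers and quotients -/

section LowerCentralSeries

variable {K : Type u} [Field K] {L : Type v} [LieRing L] [LieAlgebra K L]

theorem lie_mem_lcSeries_succ (x : L) {y : L} {k : ℕ} (hy : y ∈ lcSeries K L k) :
    ⁅x, y⁆ ∈ lcSeries K L (k + 1) := by
  rw [lcSeries, LieModule.lowerCentralSeries_succ]
  exact LieSubmodule.lie_mem_lie (LieSubmodule.mem_top x) hy

theorem lcSeries_anti {j k : ℕ} (h : j ≤ k) : lcSeries K L k ≤ lcSeries K L j :=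
  LieModule.antitone_lowerCentralSeries K L L h

theorem mem_lcSeries_zero (x : L) : x ∈ lcSeries K L 0 := by simp

/-- The next term is already the linear span of brackets, so `p` has to be linear but need not be
stable under bracketing. -/
theorem lcSeries_succ_induction {k : ℕ} {p : L → Prop} (h0 : p 0)
    (hadd : ∀ x y, p x → p y → p (x + y)) (hsmul : ∀ (c : K) x, p x → p (c • x))
    (hlie : ∀ x y : L, y ∈ lcSeries K L k → p ⁅x, y⁆) {x : L} (hx : x ∈ lcSeries K L (k + 1)) :
    p x := by
  rw [lcSeries, LieModule.lowerCentralSeries_succ, ← LieSubmodule.mem_toSubmodule,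
    LieSubmodule.lieIdeal_oper_eq_linear_span'] at hx
  induction hx using Submodule.span_induction with
  | mem x hx => obtain ⟨a, -, b, hb, rfl⟩ := hx; exact hlie a b hb
  | zero => exact h0
  | add x y _ _ hx hy => exact hadd x y hx hy
  | smul c x _ hx => exact hsmul c x hx

/-- Induction on `j` by the Jacobi identity. The extra `1` is due to indexing from `0`: `lcSeries K
L j` is `L^(j+1)`. -/
theorem lie_mem_lcSeries_add {j : ℕ} : ∀ {k : ℕ} {x y : L}, x ∈ lcSeries K L j →
    y ∈ lcSeries K L k → ⁅x, y⁆ ∈ lcSeries K L (j + k + 1) := by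
  induction j with
  | zero =>
    intro k x y _ hy
    simpa using lie_mem_lcSeries_succ x hy
  | succ j ih =>
    intro k x y hx hy
    refine lcSeries_succ_induction (p := fun x => ⁅x, y⁆ ∈ lcSeries K L (j + 1 + k + 1))
      (by simp) (fun a b ha hb => ?_) (fun c a ha => ?_) (fun a b hb => ?_) hx
    · rw [add_lie]; exact add_mem ha hb
    · rw [smul_lie]; exact Submodule.smul_mem _ c ha
    · rw [lie_lie]
      have h1 := lie_mem_lcSeries_succ a (ih hb hy)
      have h2 := ih hb (lie_mem_lcSeries_succ a hy)
      have e1 : j + k + 1 + 1 = j + 1 + k + 1 := by ring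
      have e2 : j + (k + 1) + 1 = j + 1 + k + 1 := by ring
      rw [e1] at h1
      rw [e2] at h2
      exact sub_mem h1 h2

/-- If `T` generates `L` modulo `⁅L, L⁆` and `S` generates a term of the lower central series modulo
the next one, then the brackets of `T` with `S` generate the next one modulo its successor. -/
theorem lcSeries_succ_le_span_sup {T S : Set L} {k : ℕ}
    (hT : Submodule.span K T ⊔ (lcSeries K L 1).toSubmodule = ⊤)
    (hS : (lcSeries K L k).toSubmodule ≤
      Submodule.span K S ⊔ (lcSeries K L (k + 1)).toSubmodule) :
    (lcSeries K L (k + 1)).toSubmodule ≤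
      Submodule.span K (Set.image2 (fun x y => ⁅x, y⁆) T S) ⊔
        (lcSeries K L (k + 2)).toSubmodule := by
  intro x hx
  refine lcSeries_succ_induction (p := fun x => x ∈ Submodule.span K
    (Set.image2 (fun x y => ⁅x, y⁆) T S) ⊔ (lcSeries K L (k + 2)).toSubmodule)
    (zero_mem _) (fun a b ha hb => add_mem ha hb) (fun c a ha => Submodule.smul_mem _ c ha)
    (fun a b hb => ?_) hx
  obtain ⟨a₁, ha₁, a₂, ha₂, rfl⟩ := Submodule.mem_sup.1 (hT ▸ Submodule.mem_top : a ∈ _)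
  obtain ⟨b₁, hb₁, b₂, hb₂, rfl⟩ := Submodule.mem_sup.1 (hS hb)
  have hb₁' : b₁ ∈ lcSeries K L k := by
    have := sub_mem hb (lcSeries_anti (Nat.le_succ k) hb₂)
    simpa using this
  have h := Submodule.apply_mem_map₂ (LieModule.toEnd K L L : L →ₗ[K] L →ₗ[K] L) ha₁ hb₁
  rw [Submodule.map₂_span_span] at h
  -- Only the bracket of the leading parts matters; the other two lie one term deeper.
  have e : ⁅a₁ + a₂, b₁ + b₂⁆ = ⁅a₁, b₁⁆ + (⁅a₁ + a₂, b₂⁆ + ⁅a₂, b₁⁆) := by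
    simp only [add_lie, lie_add]; abel
  rw [e]
  refine Submodule.add_mem_sup h (add_mem (lie_mem_lcSeries_succ _ hb₂) ?_)
  have := lie_mem_lcSeries_add ha₂ hb₁'
  rwa [show 1 + k + 1 = k + 2 by ring] at this

/-- Jacobi, since `⁅⁅b, a⁆, ⁅a, b⁆⁆ = 0`. It reduces the spanning set of the fourth layer from four
brackets to three. -/
theorem lie_lie_lie_comm (a b : L) : ⁅b, ⁅a, ⁅a, b⁆⁆⁆ = ⁅a, ⁅b, ⁅a, b⁆⁆⁆ := by
  rw [leibniz_lie b a, ← lie_skew b a, neg_lie, lie_self, neg_zero, zero_add]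

section TwoGenerators

variable {a b : L} (hab : Submodule.span K {a, b} ⊔ (lcSeries K L 1).toSubmodule = ⊤)
include hab

theorem exists_sub_mem_lcSeries_one (x : L) : ∃ α β : K, ∃ u ∈ lcSeries K L 1,
    x = α • a + β • b + u := by
  obtain ⟨y, hy, u, hu, rfl⟩ := Submodule.mem_sup.1 (hab ▸ Submodule.mem_top : x ∈ _)
  obtain ⟨α, β, rfl⟩ := Submodule.mem_span_pair.1 hy
  exact ⟨α, β, u, hu, rfl⟩

theorem lcSeries_one_le_span :
    (lcSeries K L 1).toSubmodule ≤ Submodule.span K {⁅a, b⁆} ⊔ (lcSeries K L 2).toSubmodule := by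
  refine (lcSeries_succ_le_span_sup (k := 0) hab (le_trans le_top hab.ge)).trans
    (sup_le_sup_right (Submodule.span_le.2 ?_) _)
  have h := Submodule.mem_span_singleton_self (R := K) ⁅a, b⁆
  rintro - ⟨x, (rfl | rfl), y, (rfl | rfl), rfl⟩
  · simp
  · exact h
  · simpa only [SetLike.mem_coe, lie_skew] using neg_mem h
  · simp

theorem lcSeries_two_le_span :
    (lcSeries K L 2).toSubmodule ≤
      Submodule.span K {⁅a, ⁅a, b⁆⁆, ⁅b, ⁅a, b⁆⁆} ⊔ (lcSeries K L 3).toSubmodule := by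
  refine (lcSeries_succ_le_span_sup (k := 1) hab (lcSeries_one_le_span hab)).trans
    (sup_le_sup_right (Submodule.span_mono ?_) _)
  rintro - ⟨x, (rfl | rfl), y, rfl, rfl⟩ <;> simp

theorem lcSeries_three_le_span :
    (lcSeries K L 3).toSubmodule ≤
      Submodule.span K {⁅a, ⁅a, ⁅a, b⁆⁆⁆, ⁅a, ⁅b, ⁅a, b⁆⁆⁆, ⁅b, ⁅b, ⁅a, b⁆⁆⁆} ⊔
        (lcSeries K L 4).toSubmodule := by
  refine (lcSeries_succ_le_span_sup (k := 2) hab (lcSeries_two_le_span hab)).trans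
    (sup_le_sup_right (Submodule.span_mono ?_) _)
  rintro - ⟨x, (rfl | rfl), y, (rfl | rfl), rfl⟩
  · simp
  · simp
  · simp [lie_lie_lie_comm]
  · simp

theorem exists_sub_mem_lcSeries_two {x : L} (hx : x ∈ lcSeries K L 1) :
    ∃ γ : K, ∃ u ∈ lcSeries K L 2, x = γ • ⁅a, b⁆ + u := by
  obtain ⟨y, hy, u, hu, rfl⟩ := Submodule.mem_sup.1 (lcSeries_one_le_span hab hx)
  obtain ⟨γ, rfl⟩ := Submodule.mem_span_singleton.1 hy
  exact ⟨γ, u, hu, rfl⟩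

theorem exists_sub_mem_lcSeries_three {x : L} (hx : x ∈ lcSeries K L 2) :
    ∃ α β : K, ∃ u ∈ lcSeries K L 3, x = α • ⁅a, ⁅a, b⁆⁆ + β • ⁅b, ⁅a, b⁆⁆ + u := by
  obtain ⟨y, hy, u, hu, rfl⟩ := Submodule.mem_sup.1 (lcSeries_two_le_span hab hx)
  obtain ⟨α, β, rfl⟩ := Submodule.mem_span_pair.1 hy
  exact ⟨α, β, u, hu, rfl⟩

theorem exists_sub_mem_lcSeries_four {x : L} (hx : x ∈ lcSeries K L 3) :
    ∃ α β γ : K, ∃ u ∈ lcSeries K L 4, x = α • ⁅a, ⁅a, ⁅a, b⁆⁆⁆ + β • ⁅a, ⁅b, ⁅a, b⁆⁆⁆ +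
      γ • ⁅b, ⁅b, ⁅a, b⁆⁆⁆ + u := by
  obtain ⟨y, hy, u, hu, rfl⟩ := Submodule.mem_sup.1 (lcSeries_three_le_span hab hx)
  obtain ⟨α, β, γ, rfl⟩ := Submodule.mem_span_triple.1 hy
  exact ⟨α, β, γ, u, hu, rfl⟩

end TwoGenerators

/-- A term of the lower central series contained in an ideal modulo the next term is contained in
it modulo every term. -/
theorem lcSeries_le_sup {J : LieIdeal K L} {k : ℕ} (h : lcSeries K L k ≤ J ⊔ lcSeries K L (k + 1))
    (m : ℕ) : lcSeries K L (k + m) ≤ J ⊔ lcSeries K L (k + m + 1) := by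
  induction m with
  | zero => exact h
  | succ m ih =>
    intro x hx
    refine lcSeries_succ_induction (p := fun x => x ∈ J ⊔ lcSeries K L (k + (m + 1) + 1))
      (zero_mem _) (fun a b ha hb => add_mem ha hb) (fun c a ha => Submodule.smul_mem _ c ha)
      (fun a b hb => ?_) hx
    obtain ⟨y, hy, z, hz, rfl⟩ := (LieSubmodule.mem_sup _ _ _).1 (ih hb)
    rw [lie_add]
    exact (LieSubmodule.mem_sup _ _ _).2
      ⟨_, lie_mem_right K L J a y hy, _, lie_mem_lcSeries_succ a hz, rfl⟩

/-- The inclusion modulo the next term propagates to every later term, until one is reached that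
lies in `J`. -/
theorem lcSeries_le_of_le_sup {J : LieIdeal K L} {k t : ℕ}
    (h : lcSeries K L k ≤ J ⊔ lcSeries K L (k + 1)) (ht : lcSeries K L t ≤ J) :
    lcSeries K L k ≤ J := by
  have key : ∀ m, lcSeries K L k ≤ J ⊔ lcSeries K L (k + m) := by
    intro m
    induction m with
    | zero => exact le_sup_right
    | succ m ih => exact ih.trans (sup_le le_sup_left (lcSeries_le_sup h m))
  exact (key t).trans (sup_le le_rfl ((lcSeries_anti (Nat.le_add_left t k)).trans ht))

/-- Generators modulo `L^2` generate a nilpotent `L`: elements of `R` approximate any given element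
modulo deeper and deeper terms. -/
theorem LieSubalgebra.eq_top_of_sup_lcSeries_one {R : LieSubalgebra K L} {t : ℕ}
    (hR : R.toSubmodule ⊔ (lcSeries K L 1).toSubmodule = ⊤) (ht : lcSeries K L t = ⊥) : R = ⊤ := by
  -- The approximation is kept inside the same term, so that bracketing it with an element of `R`
  -- lands in the next term and the induction goes on.
  have key : ∀ k, ∀ x ∈ lcSeries K L k, ∃ y ∈ R, y ∈ lcSeries K L k ∧
      x - y ∈ lcSeries K L (k + 1) := by
    intro k
    induction k with
    | zero =>
      intro x _
      obtain ⟨y, hy, u, hu, rfl⟩ := Submodule.mem_sup.1 (hR ▸ Submodule.mem_top : x ∈ _)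
      exact ⟨y, hy, mem_lcSeries_zero y, by simpa using hu⟩
    | succ k ih =>
      intro x hx
      refine lcSeries_succ_induction (p := fun x => ∃ y ∈ R, y ∈ lcSeries K L (k + 1) ∧
        x - y ∈ lcSeries K L (k + 1 + 1)) ⟨0, by simp⟩ ?_ ?_ ?_ hx
      · rintro x x' ⟨y, hy, hy', hxy⟩ ⟨z, hz, hz', hxz⟩
        refine ⟨y + z, add_mem hy hz, add_mem hy' hz', ?_⟩
        rw [add_sub_add_comm]
        exact add_mem hxy hxz
      · rintro c x ⟨y, hy, hy', hxy⟩
        refine ⟨c • y, R.smul_mem c hy, Submodule.smul_mem _ c hy', ?_⟩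
        rw [← smul_sub]
        exact Submodule.smul_mem _ c hxy
      · intro x z hz
        obtain ⟨y, hy, hy', hzy⟩ := ih z hz
        obtain ⟨r, hr, u, hu, rfl⟩ := Submodule.mem_sup.1 (hR ▸ Submodule.mem_top : x ∈ _)
        refine ⟨⁅r, y⁆, R.lie_mem hr hy, lie_mem_lcSeries_succ r hy', ?_⟩
        have e : ⁅r + u, z⁆ - ⁅r, y⁆ = ⁅r, z - y⁆ + ⁅u, z⁆ := by
          simp only [add_lie, lie_sub]; abel
        rw [e]
        have h := lie_mem_lcSeries_add (K := K) hu hz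
        rw [show 1 + k + 1 = k + 1 + 1 by ring] at h
        exact add_mem (lie_mem_lcSeries_succ r hzy) h
  have main : ∀ k, ∀ x : L, ∃ y ∈ R, x - y ∈ lcSeries K L k := by
    intro k
    induction k with
    | zero => exact fun x => ⟨0, zero_mem _, mem_lcSeries_zero _⟩
    | succ k ih =>
      intro x
      obtain ⟨y, hy, hxy⟩ := ih x
      obtain ⟨z, hz, -, hxz⟩ := key k _ hxy
      exact ⟨y + z, add_mem hy hz, by rwa [← sub_sub]⟩
  rw [eq_top_iff]
  intro x _
  obtain ⟨y, hy, hxy⟩ := main t x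
  rw [ht, LieSubmodule.mem_bot, sub_eq_zero] at hxy
  exact hxy ▸ hy

theorem mem_lcSeries_iff_of_surjective {L' : Type*} [LieRing L'] [LieAlgebra K L']
    {f : L →ₗ⁅K⁆ L'} (hf : Function.Surjective f) (k : ℕ) (y : L') :
    y ∈ lcSeries K L' k ↔ ∃ x ∈ lcSeries K L k, f x = y := by
  rw [lcSeries, ← LieIdeal.lowerCentralSeries_map_eq k hf, ← LieSubmodule.mem_toSubmodule,
    LieIdeal.coe_map_of_surjective hf]
  rfl

theorem map_mem_lcSeries {L' : Type*} [LieRing L'] [LieAlgebra K L'] (f : L →ₗ⁅K⁆ L') {k : ℕ}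
    {x : L} (hx : x ∈ lcSeries K L k) : f x ∈ lcSeries K L' k :=
  LieIdeal.map_lowerCentralSeries_le k (LieIdeal.mem_map hx)

end LowerCentralSeries

/-! ### An explicit 8-dimensional model of the free nilpotent algebra -/

/-- The free nilpotent Lie algebra of nilindex `4` on two generators in coordinates: with respect to
the basis `v₀, v₁, w₀, z₀, z₁, [v₀, z₀], [v₀, z₁], [v₁, z₁]`. -/
def CoordFreeNilpotent (K : Type u) : Type u := Fin 8 → K

namespace CoordFreeNilpotent

variable {K : Type u}

/-- The element with given coordinates. -/
def mk (a0 a1 a2 a3 a4 a5 a6 a7 : K) : CoordFreeNilpotent K := ![a0, a1, a2, a3, a4, a5, a6, a7]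

theorem ext_coords {x y : CoordFreeNilpotent K} (h0 : x 0 = y 0) (h1 : x 1 = y 1) (h2 : x 2 = y 2)
    (h3 : x 3 = y 3) (h4 : x 4 = y 4) (h5 : x 5 = y 5) (h6 : x 6 = y 6) (h7 : x 7 = y 7) :
    x = y := by
  funext i; fin_cases i <;> assumption

section

variable (a0 a1 a2 a3 a4 a5 a6 a7 : K)

@[simp] theorem mk_apply_zero : mk a0 a1 a2 a3 a4 a5 a6 a7 0 = a0 := rfl
@[simp] theorem mk_apply_one : mk a0 a1 a2 a3 a4 a5 a6 a7 1 = a1 := rfl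
@[simp] theorem mk_apply_two : mk a0 a1 a2 a3 a4 a5 a6 a7 2 = a2 := rfl
@[simp] theorem mk_apply_three : mk a0 a1 a2 a3 a4 a5 a6 a7 3 = a3 := rfl
@[simp] theorem mk_apply_four : mk a0 a1 a2 a3 a4 a5 a6 a7 4 = a4 := rfl
@[simp] theorem mk_apply_five : mk a0 a1 a2 a3 a4 a5 a6 a7 5 = a5 := rfl
@[simp] theorem mk_apply_six : mk a0 a1 a2 a3 a4 a5 a6 a7 6 = a6 := rfl
@[simp] theorem mk_apply_seven : mk a0 a1 a2 a3 a4 a5 a6 a7 7 = a7 := rfl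

end

variable [Field K]

instance : AddCommGroup (CoordFreeNilpotent K) := inferInstanceAs (AddCommGroup (Fin 8 → K))

instance : Module K (CoordFreeNilpotent K) := inferInstanceAs (Module K (Fin 8 → K))

@[simp] theorem add_apply (x y : CoordFreeNilpotent K) (i : Fin 8) : (x + y) i = x i + y i := rfl

@[simp] theorem zero_apply (i : Fin 8) : (0 : CoordFreeNilpotent K) i = 0 := rfl

@[simp] theorem smul_apply (c : K) (x : CoordFreeNilpotent K) (i : Fin 8) :
    (c • x) i = c * x i := rfl

/-- Coordinate 6 receives both `[v₀, z₁]` and `[v₁, z₀]`, which are equal. Using `[v₀, z₁]` instead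
of `x₁` as basis vector avoids factors of 2, so the model works in any characteristic. -/
instance : Bracket (CoordFreeNilpotent K) (CoordFreeNilpotent K) where
  bracket x y := mk 0 0 (x 0 * y 1 - x 1 * y 0) (x 0 * y 2 - y 0 * x 2) (x 1 * y 2 - y 1 * x 2)
    (x 0 * y 3 - y 0 * x 3) (x 0 * y 4 + x 1 * y 3 - y 0 * x 4 - y 1 * x 3) (x 1 * y 4 - y 1 * x 4)

theorem lie_def (x y : CoordFreeNilpotent K) : ⁅x, y⁆ =
    mk 0 0 (x 0 * y 1 - x 1 * y 0) (x 0 * y 2 - y 0 * x 2) (x 1 * y 2 - y 1 * x 2)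
      (x 0 * y 3 - y 0 * x 3) (x 0 * y 4 + x 1 * y 3 - y 0 * x 4 - y 1 * x 3)
      (x 1 * y 4 - y 1 * x 4) := rfl

instance : LieRing (CoordFreeNilpotent K) where
  add_lie x y z := by apply ext_coords <;> simp [lie_def] <;> ring
  lie_add x y z := by apply ext_coords <;> simp [lie_def] <;> ring
  lie_self x := by apply ext_coords <;> (simp [lie_def]; try ring)
  leibniz_lie x y z := by apply ext_coords <;> simp [lie_def] <;> ring

instance : LieAlgebra K (CoordFreeNilpotent K) where
  lie_smul c x y := by apply ext_coords <;> simp [lie_def] <;> ring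

/-- The degrees of the basis vectors, lowered by one. -/
def deg : Fin 8 → ℕ := ![0, 0, 1, 2, 2, 3, 3, 3]

theorem apply_eq_zero_of_mem_lcSeries {k : ℕ} {x : CoordFreeNilpotent K}
    (hx : x ∈ lcSeries K (CoordFreeNilpotent K) k) {i : Fin 8} (hi : deg i < k) : x i = 0 := by
  induction k generalizing x i with
  | zero => exact absurd hi (Nat.not_lt_zero _)
  | succ k ih =>
    refine lcSeries_succ_induction (p := fun x => x i = 0) rfl (fun x y hx hy => ?_)
      (fun c x hx => ?_) (fun x y hy => ?_) hx
    · rw [add_apply, hx, hy, add_zero]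
    · rw [smul_apply, hx, mul_zero]
    · have h := fun j => ih (i := j) hy
      have h0 := @h 0
      have h1 := @h 1
      have h2 := @h 2
      have h3 := @h 3
      have h4 := @h 4
      simp only [deg, Matrix.cons_val] at h0 h1 h2 h3 h4
      fin_cases i <;> simp [deg] at hi ⊢ <;> rw [lie_def] <;> simp
      all_goals grind

end CoordFreeNilpotent

/-- The free Lie algebra on two generators. -/
abbrev FreeLieTwo (K : Type u) [Field K] : Type u := FreeLieAlgebra K (Fin 2)

/-- The free generators of the free Lie algebra on two generators. -/
noncomputable abbrev freeGen (K : Type u) [Field K] (i : Fin 2) : FreeLieTwo K :=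
  FreeLieAlgebra.of K i

/-! ### Independence of the basic brackets in the free Lie algebra -/

section FreeCoord

variable {K : Type u} [Field K]

/-- The coordinates of an element of the free Lie algebra on two generators in degree at most
four. -/
noncomputable def freeCoord (K : Type u) [Field K] :
    FreeLieTwo K →ₗ⁅K⁆ CoordFreeNilpotent K :=
  FreeLieAlgebra.lift K ![CoordFreeNilpotent.mk 1 0 0 0 0 0 0 0,
    CoordFreeNilpotent.mk 0 1 0 0 0 0 0 0]

theorem freeCoord_of_zero : freeCoord K (freeGen K 0) = CoordFreeNilpotent.mk 1 0 0 0 0 0 0 0 := by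
  simp [freeCoord]

theorem freeCoord_of_one : freeCoord K (freeGen K 1) = CoordFreeNilpotent.mk 0 1 0 0 0 0 0 0 := by
  simp [freeCoord]

theorem freeCoord_w : freeCoord K ⁅freeGen K 0, freeGen K 1⁆ =
    CoordFreeNilpotent.mk 0 0 1 0 0 0 0 0 := by
  rw [LieHom.map_lie, freeCoord_of_zero, freeCoord_of_one, CoordFreeNilpotent.lie_def]
  simp

theorem freeCoord_z_zero : freeCoord K ⁅freeGen K 0, ⁅freeGen K 0, freeGen K 1⁆⁆ =
    CoordFreeNilpotent.mk 0 0 0 1 0 0 0 0 := by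
  rw [LieHom.map_lie, freeCoord_w, freeCoord_of_zero, CoordFreeNilpotent.lie_def]
  simp

theorem freeCoord_z_one : freeCoord K ⁅freeGen K 1, ⁅freeGen K 0, freeGen K 1⁆⁆ =
    CoordFreeNilpotent.mk 0 0 0 0 1 0 0 0 := by
  rw [LieHom.map_lie, freeCoord_w, freeCoord_of_one, CoordFreeNilpotent.lie_def]
  simp

theorem freeCoord_x_zero : freeCoord K ⁅freeGen K 0, ⁅freeGen K 0, ⁅freeGen K 0, freeGen K 1⁆⁆⁆ =
    CoordFreeNilpotent.mk 0 0 0 0 0 1 0 0 := by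
  rw [LieHom.map_lie, freeCoord_z_zero, freeCoord_of_zero, CoordFreeNilpotent.lie_def]
  simp

theorem freeCoord_x_one : freeCoord K ⁅freeGen K 0, ⁅freeGen K 1, ⁅freeGen K 0, freeGen K 1⁆⁆⁆ =
    CoordFreeNilpotent.mk 0 0 0 0 0 0 1 0 := by
  rw [LieHom.map_lie, freeCoord_z_one, freeCoord_of_zero, CoordFreeNilpotent.lie_def]
  simp

theorem freeCoord_x_two : freeCoord K ⁅freeGen K 1, ⁅freeGen K 1, ⁅freeGen K 0, freeGen K 1⁆⁆⁆ =
    CoordFreeNilpotent.mk 0 0 0 0 0 0 0 1 := by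
  rw [LieHom.map_lie, freeCoord_z_one, freeCoord_of_one, CoordFreeNilpotent.lie_def]
  simp

theorem freeCoord_apply_eq_zero {k : ℕ} {x : FreeLieTwo K}
    (hx : x ∈ lcSeries K (FreeLieTwo K) k) {i : Fin 8}
    (hi : CoordFreeNilpotent.deg i < k) : freeCoord K x i = 0 :=
  CoordFreeNilpotent.apply_eq_zero_of_mem_lcSeries (map_mem_lcSeries _ hx) hi

/-- Here and in the next three lemmas the coefficients are coordinates in the model, and those of
too low degree vanish on the given term of the series. -/
theorem eq_zero_of_mem_lcSeries_one {α β : K}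
    (h : α • freeGen K 0 + β • freeGen K 1 ∈ lcSeries K (FreeLieTwo K) 1) : α = 0 ∧ β = 0 := by
  have h0 := freeCoord_apply_eq_zero h (i := 0) (by decide)
  have h1 := freeCoord_apply_eq_zero h (i := 1) (by decide)
  simp only [map_add, map_smul, freeCoord_of_zero, freeCoord_of_one] at h0 h1
  simpa using And.intro h0 h1

theorem eq_zero_of_mem_lcSeries_two {γ : K}
    (h : γ • ⁅freeGen K 0, freeGen K 1⁆ ∈
      lcSeries K (FreeLieTwo K) 2) : γ = 0 := by
  have h0 := freeCoord_apply_eq_zero h (i := 2) (by decide)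
  simpa only [map_smul, freeCoord_w, CoordFreeNilpotent.smul_apply,
    CoordFreeNilpotent.mk_apply_two, mul_one] using h0

theorem eq_zero_of_mem_lcSeries_three {α β : K}
    (h : α • ⁅freeGen K 0, ⁅freeGen K 0, freeGen K 1⁆⁆ +
      β • ⁅freeGen K 1, ⁅freeGen K 0, freeGen K 1⁆⁆ ∈
      lcSeries K (FreeLieTwo K) 3) : α = 0 ∧ β = 0 := by
  have h0 := freeCoord_apply_eq_zero h (i := 3) (by decide)
  have h1 := freeCoord_apply_eq_zero h (i := 4) (by decide)
  simp only [map_add, map_smul, freeCoord_z_zero, freeCoord_z_one] at h0 h1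
  simpa using And.intro h0 h1

theorem eq_zero_of_mem_lcSeries_four {α β γ : K}
    (h : α • ⁅freeGen K 0, ⁅freeGen K 0,
        ⁅freeGen K 0, freeGen K 1⁆⁆⁆ +
      β • ⁅freeGen K 0, ⁅freeGen K 1,
        ⁅freeGen K 0, freeGen K 1⁆⁆⁆ +
      γ • ⁅freeGen K 1, ⁅freeGen K 1,
        ⁅freeGen K 0, freeGen K 1⁆⁆⁆ ∈
      lcSeries K (FreeLieTwo K) 4) : α = 0 ∧ β = 0 ∧ γ = 0 := by
  have h0 := freeCoord_apply_eq_zero h (i := 5) (by decide)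
  have h1 := freeCoord_apply_eq_zero h (i := 6) (by decide)
  have h2 := freeCoord_apply_eq_zero h (i := 7) (by decide)
  simp only [map_add, map_smul, freeCoord_x_zero, freeCoord_x_one, freeCoord_x_two] at h0 h1 h2
  simpa using And.intro h0 (And.intro h1 h2)

end FreeCoord

/-! ### Generators, quotients and type 2 -/

section Generation

variable {K : Type u} [Field K] {L : Type v} [LieRing L] [LieAlgebra K L]

/-- The lift of the generators to `R`, followed by the inclusion, fixes the generators and is
therefore the identity. -/
theorem FreeLieAlgebra.eq_top_of_of_mem {X : Type*} {R : LieSubalgebra K (FreeLieAlgebra K X)}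
    (h : ∀ i, FreeLieAlgebra.of K i ∈ R) : R = ⊤ := by
  let g : FreeLieAlgebra K X →ₗ⁅K⁆ R := FreeLieAlgebra.lift K fun i => ⟨_, h i⟩
  have hg : R.incl.comp g = LieHom.id := by
    ext i
    simp [g]
  rw [eq_top_iff]
  intro x _
  have := LieHom.congr_fun hg x
  rw [LieHom.comp_apply, LieHom.id_apply] at this
  exact this ▸ (g x).2

theorem span_freeGen_sup_lcSeries_one :
    Submodule.span K {freeGen K 0, freeGen K 1} ⊔ (lcSeries K (FreeLieTwo K) 1).toSubmodule = ⊤ := by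
  -- A subspace containing all brackets is automatically a subalgebra.
  let R : LieSubalgebra K (FreeLieTwo K) :=
    { Submodule.span K {freeGen K 0, freeGen K 1} ⊔ (lcSeries K (FreeLieTwo K) 1).toSubmodule with
      lie_mem' := fun {x y} _ _ =>
        Submodule.mem_sup_right (lie_mem_lcSeries_succ (k := 0) x (mem_lcSeries_zero y)) }
  have hR : R = ⊤ := FreeLieAlgebra.eq_top_of_of_mem fun i =>
    Submodule.mem_sup_left (Submodule.subset_span (by fin_cases i <;> simp))
  have := congrArg LieSubalgebra.toSubmodule hR
  simpa [R] using this

theorem span_map_sup_lcSeries_one {L' : Type*} [LieRing L'] [LieAlgebra K L'] {f : L →ₗ⁅K⁆ L'}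
    (hf : Function.Surjective f) {a b : L}
    (h : Submodule.span K {a, b} ⊔ (lcSeries K L 1).toSubmodule = ⊤) :
    Submodule.span K {f a, f b} ⊔ (lcSeries K L' 1).toSubmodule = ⊤ := by
  rw [eq_top_iff]
  intro y _
  obtain ⟨x, rfl⟩ := hf y
  obtain ⟨α, β, u, hu, rfl⟩ := exists_sub_mem_lcSeries_one h x
  rw [map_add, map_add, map_smul, map_smul]
  exact Submodule.add_mem_sup (Submodule.mem_span_pair.2 ⟨α, β, rfl⟩) (map_mem_lcSeries f hu)

/-- The projection of a Lie algebra to its quotient by an ideal. -/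
def LieIdeal.quotHom (I : LieIdeal K L) : L →ₗ⁅K⁆ L ⧸ I :=
  { (LieSubmodule.Quotient.mk' I : L →ₗ[K] L ⧸ I) with
    map_lie' := fun {x y} => LieSubmodule.Quotient.mk_bracket I x y }

theorem LieIdeal.quotHom_surjective (I : LieIdeal K L) : Function.Surjective I.quotHom :=
  LieSubmodule.Quotient.surjective_mk' I

theorem LieIdeal.quotHom_eq_zero_iff (I : LieIdeal K L) {x : L} : I.quotHom x = 0 ↔ x ∈ I :=
  LieSubmodule.Quotient.mk_eq_zero'

/-- A homomorphism of Lie algebras vanishing on an ideal factors through the quotient. -/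
def LieIdeal.quotLift {L' : Type*} [LieRing L'] [LieAlgebra K L'] (I : LieIdeal K L)
    (f : L →ₗ⁅K⁆ L') (h : ∀ x ∈ I, f x = 0) : L ⧸ I →ₗ⁅K⁆ L' :=
  { I.toSubmodule.liftQ (f : L →ₗ[K] L') h with
    map_lie' := fun {x y} => by
      obtain ⟨x, rfl⟩ := I.quotHom_surjective x
      obtain ⟨y, rfl⟩ := I.quotHom_surjective y
      rw [← LieHom.map_lie]
      exact f.map_lie x y }

theorem LieIdeal.quotLift_quotHom {L' : Type*} [LieRing L'] [LieAlgebra K L'] (I : LieIdeal K L)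
    (f : L →ₗ⁅K⁆ L') (h : ∀ x ∈ I, f x = 0) (x : L) : I.quotLift f h (I.quotHom x) = f x := rfl

theorem LieHom.nonempty_equiv_quotient_ker {L' : Type*} [LieRing L'] [LieAlgebra K L']
    {f : L →ₗ⁅K⁆ L'} (hf : Function.Surjective f) : Nonempty (L' ≃ₗ⁅K⁆ L ⧸ f.ker) := by
  refine ⟨(LieEquiv.ofBijective (f.ker.quotLift f fun x hx => (LieHom.mem_ker).1 hx)
    ⟨?_, fun y => ?_⟩).symm⟩
  · rw [injective_iff_map_eq_zero]
    intro x hx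
    obtain ⟨x, rfl⟩ := f.ker.quotHom_surjective x
    rw [LieIdeal.quotLift_quotHom] at hx
    exact f.ker.quotHom_eq_zero_iff.2 ((LieHom.mem_ker).2 hx)
  · obtain ⟨x, rfl⟩ := hf y
    exact ⟨f.ker.quotHom x, rfl⟩

/-- A Lie algebra has type `2` if and only if two elements form a basis of it modulo the derived
algebra. -/
theorem hasLieType_two_iff [FiniteDimensional K L] : HasLieType K L 2 ↔
    ∃ a b : L, Submodule.span K {a, b} ⊔ (lcSeries K L 1).toSubmodule = ⊤ ∧
      ∀ α β : K, α • a + β • b ∈ lcSeries K L 1 → α = 0 ∧ β = 0 := by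
  constructor
  · rintro ⟨-, h⟩
    obtain ⟨C, hC⟩ := (lcSeries K L 1).toSubmodule.exists_isCompl
    have h2 : Module.finrank K C = 2 := by
      have := Submodule.finrank_add_eq_of_isCompl hC
      have h' : Module.finrank K L = Module.finrank K (lcSeries K L 1) + 2 := h
      change Module.finrank K (lcSeries K L 1) + _ = _ at this
      omega
    let e := Module.finBasisOfFinrankEq K C h2
    refine ⟨e 0, e 1, ?_, fun α β hαβ => ?_⟩
    · rw [eq_top_iff, ← hC.symm.sup_eq_top]
      refine sup_le_sup_right (fun x hx => ?_) _
      rw [Submodule.mem_span_pair]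
      refine ⟨e.repr ⟨x, hx⟩ 0, e.repr ⟨x, hx⟩ 1, ?_⟩
      have := congrArg Subtype.val (e.sum_repr ⟨x, hx⟩)
      rw [Fin.sum_univ_two] at this
      exact this
    · have hmem : α • (e 0 : L) + β • (e 1 : L) ∈ C :=
        add_mem (C.smul_mem _ (e 0).2) (C.smul_mem _ (e 1).2)
      have h0 := Submodule.disjoint_def.1 hC.disjoint _ hαβ hmem
      have h0' : α • e 0 + β • e 1 = 0 := Subtype.ext (by simpa using h0)
      have hsum : ∑ i, ![α, β] i • e i = 0 := by simpa [Fin.sum_univ_two] using h0'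
      have := Fintype.linearIndependent_iff.1 e.linearIndependent _ hsum
      exact ⟨this 0, this 1⟩
  · rintro ⟨a, b, hsup, hli⟩
    refine ⟨inferInstance, ?_⟩
    have hC : IsCompl (Submodule.span K {a, b}) (lcSeries K L 1).toSubmodule := by
      refine ⟨Submodule.disjoint_def.2 fun x hx hx' => ?_, codisjoint_iff.2 hsup⟩
      obtain ⟨α, β, rfl⟩ := Submodule.mem_span_pair.1 hx
      obtain ⟨rfl, rfl⟩ := hli α β hx'
      simp
    have h2 : Module.finrank K (Submodule.span K {a, b}) = 2 := by
      have hli' : LinearIndependent K ![a, b] := LinearIndependent.pair_iff.2 fun α β h =>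
        hli α β (h ▸ zero_mem _)
      have := finrank_span_eq_card hli'
      rwa [Matrix.range_cons, Matrix.range_cons, Matrix.range_empty, Set.union_empty,
        ← Set.insert_eq, Fintype.card_fin] at this
    have := Submodule.finrank_add_eq_of_isCompl hC
    change _ + Module.finrank K (lcSeries K L 1) = _ at this
    change Module.finrank K L = Module.finrank K (lcSeries K L 1) + 2
    omega

theorem finiteDimensional_lcSeries_of_le {S : Set L} (hS : S.Finite) {k : ℕ}
    (h : (lcSeries K L k).toSubmodule ≤
      Submodule.span K S ⊔ (lcSeries K L (k + 1)).toSubmodule)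
    (hk : FiniteDimensional K (lcSeries K L (k + 1)).toSubmodule) :
    FiniteDimensional K (lcSeries K L k).toSubmodule := by
  have := FiniteDimensional.span_of_finite K hS
  exact Submodule.finiteDimensional_of_le h

/-- Descent from `L^5 = 0`: each layer is spanned by finitely many brackets. -/
theorem finiteDimensional_of_lcSeries_four_eq_bot {a b : L}
    (h : Submodule.span K {a, b} ⊔ (lcSeries K L 1).toSubmodule = ⊤)
    (h4 : lcSeries K L 4 = ⊥) : FiniteDimensional K L := by
  have f4 : FiniteDimensional K (lcSeries K L 4).toSubmodule := by
    rw [h4]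
    exact inferInstanceAs (FiniteDimensional K (⊥ : Submodule K L))
  have f3 := finiteDimensional_lcSeries_of_le (by simp) (lcSeries_three_le_span h) f4
  have f2 := finiteDimensional_lcSeries_of_le (by simp) (lcSeries_two_le_span h) f3
  have f1 := finiteDimensional_lcSeries_of_le (by simp) (lcSeries_one_le_span h) f2
  have f0 : FiniteDimensional K (lcSeries K L 0).toSubmodule :=
    finiteDimensional_lcSeries_of_le (S := {a, b}) (by simp) (le_trans le_top h.ge) f1
  rw [lcSeries, LieModule.lowerCentralSeries_zero, LieSubmodule.top_toSubmodule] at f0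
  exact Module.Finite.of_surjective (⊤ : Submodule K L).subtype fun x => ⟨⟨x, trivial⟩, rfl⟩

end Generation

/-! ### The algebras `𝔫_{2,t}` and their quotients -/

namespace FreeNilpotentTwo

section

variable (K : Type u) [Field K] (t : ℕ)

/-- The projection of the free Lie algebra to the free nilpotent Lie algebra. -/
noncomputable def proj : FreeLieTwo K →ₗ⁅K⁆ FreeNilpotentTwo K t :=
  LieIdeal.quotHom (lowerCentralPower K (FreeLieTwo K) (t + 1))

theorem proj_surjective : Function.Surjective (proj K t) := LieIdeal.quotHom_surjective _

theorem proj_freeGen (i : Fin 2) : proj K t (freeGen K i) = vv K t i := rfl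

end

variable {K : Type u} [Field K] {t : ℕ}

theorem proj_eq_zero_iff {x : FreeLieTwo K} : proj K t x = 0 ↔ x ∈ lcSeries K (FreeLieTwo K) t :=
  LieIdeal.quotHom_eq_zero_iff _

/-- For `k ≤ t` the kernel of the projection lies in the term in question, so membership can be
tested in the free Lie algebra. This transfers the independence results to `𝔫_{2,t}`. -/
theorem proj_mem_lcSeries_iff {k : ℕ} (hk : k ≤ t) {x : FreeLieTwo K} :
    proj K t x ∈ lcSeries K (FreeNilpotentTwo K t) k ↔ x ∈ lcSeries K (FreeLieTwo K) k := by
  refine ⟨fun h => ?_, map_mem_lcSeries _⟩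
  obtain ⟨y, hy, hxy⟩ := (mem_lcSeries_iff_of_surjective (proj_surjective K t) k _).1 h
  rw [← sub_eq_zero, ← map_sub, proj_eq_zero_iff] at hxy
  simpa using sub_mem hy (lcSeries_anti hk hxy)

theorem lcSeries_eq_bot : lcSeries K (FreeNilpotentTwo K t) t = ⊥ := by
  rw [LieSubmodule.eq_bot_iff]
  intro x hx
  obtain ⟨y, hy, rfl⟩ := (mem_lcSeries_iff_of_surjective (proj_surjective K t) t _).1 hx
  exact proj_eq_zero_iff.2 hy

theorem span_vv_sup : Submodule.span K {vv K t 0, vv K t 1} ⊔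
    (lcSeries K (FreeNilpotentTwo K t) 1).toSubmodule = ⊤ :=
  span_map_sup_lcSeries_one (proj_surjective K t) span_freeGen_sup_lcSeries_one

theorem finiteDimensional (ht : t ≤ 4) : FiniteDimensional K (FreeNilpotentTwo K t) :=
  finiteDimensional_of_lcSeries_four_eq_bot span_vv_sup
    (le_bot_iff.1 ((lcSeries_anti ht).trans lcSeries_eq_bot.le))

theorem eq_zero_of_smul_vv_mem (ht : 1 ≤ t) {α β : K}
    (h : α • vv K t 0 + β • vv K t 1 ∈ lcSeries K (FreeNilpotentTwo K t) 1) : α = 0 ∧ β = 0 := by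
  refine eq_zero_of_mem_lcSeries_one ((proj_mem_lcSeries_iff ht).1 ?_)
  simpa only [map_add, map_smul, proj_freeGen] using h

theorem eq_zero_of_smul_ww_mem (ht : 2 ≤ t) {γ : K}
    (h : γ • ww K t ∈ lcSeries K (FreeNilpotentTwo K t) 2) : γ = 0 := by
  refine eq_zero_of_mem_lcSeries_two ((proj_mem_lcSeries_iff ht).1 ?_)
  simpa only [map_smul, LieHom.map_lie, proj_freeGen, ww] using h

theorem eq_zero_of_smul_zz_mem (ht : 3 ≤ t) {α β : K}
    (h : α • zz K t 0 + β • zz K t 1 ∈ lcSeries K (FreeNilpotentTwo K t) 3) :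
    α = 0 ∧ β = 0 := by
  refine eq_zero_of_mem_lcSeries_three ((proj_mem_lcSeries_iff ht).1 ?_)
  simpa only [map_add, map_smul, LieHom.map_lie, proj_freeGen, ww, zz] using h

theorem eq_zero_of_smul_xx_mem (ht : 4 ≤ t) {α β γ : K}
    (h : α • xx₀ K t + β • ⁅vv K t 0, zz K t 1⁆ + γ • xx₂ K t ∈
      lcSeries K (FreeNilpotentTwo K t) 4) : α = 0 ∧ β = 0 ∧ γ = 0 := by
  refine eq_zero_of_mem_lcSeries_four ((proj_mem_lcSeries_iff ht).1 ?_)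
  simpa only [map_add, map_smul, LieHom.map_lie, proj_freeGen, ww, zz, xx₀, xx₂] using h

/-- A finite-dimensional Lie algebra of type `2` and nilindex `t` is a quotient of the free
nilpotent Lie algebra of nilindex `t`. -/
theorem exists_surjective_of_hasLieType {L : Type v} [LieRing L] [LieAlgebra K L]
    (h2 : HasLieType K L 2) (h : IsNilpotentOfNilindex K L t) :
    ∃ f : FreeNilpotentTwo K t →ₗ⁅K⁆ L, Function.Surjective f ∧
      f.ker ≤ lcSeries K (FreeNilpotentTwo K t) 1 ∧
      ¬ lcSeries K (FreeNilpotentTwo K t) (t - 1) ≤ f.ker := by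
  have : FiniteDimensional K L := h2.1
  obtain ⟨a, b, hab, hli⟩ := hasLieType_two_iff.1 h2
  obtain ⟨-, ht', ht⟩ := h
  change lcSeries K L t = ⊥ at ht
  let φ : FreeLieTwo K →ₗ⁅K⁆ L := FreeLieAlgebra.lift K ![a, b]
  have hφ0 : φ (freeGen K 0) = a := by simp [φ]
  have hφ1 : φ (freeGen K 1) = b := by simp [φ]
  have hφ : Function.Surjective φ := by
    rw [← LieHom.range_eq_top]
    refine LieSubalgebra.eq_top_of_sup_lcSeries_one (top_le_iff.1 ?_) ht
    rw [← hab]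
    refine sup_le_sup_right (Submodule.span_le.2 ?_) _
    rintro x (rfl | rfl)
    · exact ⟨_, hφ0⟩
    · exact ⟨_, hφ1⟩
  let f : FreeNilpotentTwo K t →ₗ⁅K⁆ L := LieIdeal.quotLift _ φ fun x hx => by
    have := map_mem_lcSeries φ (k := t) hx
    rwa [ht, LieSubmodule.mem_bot] at this
  have hfv : ∀ i, f (vv K t i) = φ (freeGen K i) := fun i => rfl
  have hf : Function.Surjective f := fun y => by
    obtain ⟨x, rfl⟩ := hφ y
    exact ⟨proj K t x, rfl⟩
  refine ⟨f, hf, fun x hx => ?_, fun hle => ht' ?_⟩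
  -- The kernel lies in the derived algebra because `a`, `b` are independent modulo `L^2`; the
  -- remaining claim is `L^t ≠ 0`.
  · obtain ⟨α, β, u, hu, rfl⟩ := exists_sub_mem_lcSeries_one span_vv_sup x
    rw [LieHom.mem_ker, map_add, map_add, map_smul, map_smul, hfv, hfv, hφ0, hφ1] at hx
    obtain ⟨rfl, rfl⟩ := hli α β (by
      rw [eq_neg_of_add_eq_zero_left hx]
      exact neg_mem (map_mem_lcSeries f hu))
    simpa using hu
  · rw [LieSubmodule.eq_bot_iff]
    intro y hy
    obtain ⟨x, hx, rfl⟩ := (mem_lcSeries_iff_of_surjective hf (t - 1) y).1 hy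
    exact (LieHom.mem_ker).1 (hle hx)

theorem hasLieType_of_surjective {L : Type v} [LieRing L] [LieAlgebra K L] (ht1 : 1 ≤ t)
    (ht4 : t ≤ 4) {f : FreeNilpotentTwo K t →ₗ⁅K⁆ L} (hf : Function.Surjective f)
    (hker : f.ker ≤ lcSeries K (FreeNilpotentTwo K t) 1) : HasLieType K L 2 := by
  have := finiteDimensional (K := K) ht4
  have : FiniteDimensional K L := Module.Finite.of_surjective (f : FreeNilpotentTwo K t →ₗ[K] L) hf
  refine hasLieType_two_iff.2 ⟨_, _, span_map_sup_lcSeries_one hf span_vv_sup, fun α β h => ?_⟩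
  rw [← map_smul, ← map_smul, ← map_add] at h
  obtain ⟨y, hy, hxy⟩ := (mem_lcSeries_iff_of_surjective hf 1 _).1 h
  rw [eq_comm, ← sub_eq_zero, ← map_sub, ← LieHom.mem_ker] at hxy
  exact eq_zero_of_smul_vv_mem ht1 (by simpa using add_mem (hker hxy) hy)

theorem isNilpotentOfNilindex_of_surjective {L : Type v} [LieRing L] [LieAlgebra K L] (ht1 : 1 ≤ t)
    {f : FreeNilpotentTwo K t →ₗ⁅K⁆ L} (hf : Function.Surjective f)
    (hker : ¬ lcSeries K (FreeNilpotentTwo K t) (t - 1) ≤ f.ker) : IsNilpotentOfNilindex K L t := by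
  refine ⟨ht1, fun h => hker fun x hx => ?_, ?_⟩
  · have := map_mem_lcSeries f hx
    rw [LieHom.mem_ker]
    change lcSeries K L (t - 1) = ⊥ at h
    rwa [h, LieSubmodule.mem_bot] at this
  · rw [LieSubmodule.eq_bot_iff]
    intro y hy
    obtain ⟨x, hx, rfl⟩ := (mem_lcSeries_iff_of_surjective hf t y).1 hy
    rw [lcSeries_eq_bot, LieSubmodule.mem_bot] at hx
    rw [hx, map_zero]

end FreeNilpotentTwo

/-! ### Classification of the admissible ideals of `𝔫_{2,3}` and `𝔫_{2,4}` -/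

namespace FreeNilpotentTwo

variable {K : Type u} [Field K] {t : ℕ}

theorem vv_lie_xx (K : Type u) [Field K] (t : ℕ) :
    ⁅vv K t 1, zz K t 0⁆ = ⁅vv K t 0, zz K t 1⁆ := lie_lie_lie_comm _ _

theorem ww_mem : ww K t ∈ lcSeries K (FreeNilpotentTwo K t) 1 :=
  lie_mem_lcSeries_succ (k := 0) _ (mem_lcSeries_zero _)

theorem zz_mem (i : Fin 2) : zz K t i ∈ lcSeries K (FreeNilpotentTwo K t) 2 :=
  lie_mem_lcSeries_succ _ ww_mem

theorem xx_zero_mem : xx₀ K t ∈ lcSeries K (FreeNilpotentTwo K t) 3 :=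
  lie_mem_lcSeries_succ _ (zz_mem 0)

theorem lie_vv_zz_mem (i j : Fin 2) : ⁅vv K t i, zz K t j⁆ ∈ lcSeries K (FreeNilpotentTwo K t) 3 :=
  lie_mem_lcSeries_succ _ (zz_mem j)

theorem xx_one_mem : xx₁ K t ∈ lcSeries K (FreeNilpotentTwo K t) 3 :=
  Submodule.smul_mem _ _ (lie_vv_zz_mem 0 1)

theorem xx_two_mem : xx₂ K t ∈ lcSeries K (FreeNilpotentTwo K t) 3 :=
  lie_mem_lcSeries_succ _ (zz_mem 1)

theorem exists_eq_of_mem_lcSeries_one {x : FreeNilpotentTwo K t}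
    (hx : x ∈ lcSeries K (FreeNilpotentTwo K t) 1) :
    ∃ γ : K, ∃ u ∈ lcSeries K (FreeNilpotentTwo K t) 2, x = γ • ww K t + u :=
  exists_sub_mem_lcSeries_two span_vv_sup hx

theorem exists_eq_of_mem_lcSeries_two {x : FreeNilpotentTwo K t}
    (hx : x ∈ lcSeries K (FreeNilpotentTwo K t) 2) :
    ∃ α β : K, ∃ u ∈ lcSeries K (FreeNilpotentTwo K t) 3,
      x = α • zz K t 0 + β • zz K t 1 + u :=
  exists_sub_mem_lcSeries_three span_vv_sup hx

theorem exists_eq_of_mem_lcSeries_three [CharZero K] {x : FreeNilpotentTwo K t}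
    (hx : x ∈ lcSeries K (FreeNilpotentTwo K t) 3) :
    ∃ α β γ : K, ∃ u ∈ lcSeries K (FreeNilpotentTwo K t) 4,
      x = α • xx₀ K t + β • xx₁ K t + γ • xx₂ K t + u := by
  obtain ⟨α, β, γ, u, hu, rfl⟩ := exists_sub_mem_lcSeries_four span_vv_sup hx
  refine ⟨α, β / 2, γ, u, hu, ?_⟩
  rw [xx₁, smul_smul, div_mul_cancel₀ _ two_ne_zero]
  rfl

theorem eq_zero_of_smul_xx_eq_zero [CharZero K] {α β γ : K}
    (h : α • xx₀ K 4 + β • xx₁ K 4 + γ • xx₂ K 4 = 0) : α = 0 ∧ β = 0 ∧ γ = 0 := by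
  rw [xx₁, smul_smul] at h
  have := eq_zero_of_smul_xx_mem le_rfl (h ▸ zero_mem _)
  simpa using this

theorem lcSeries_three_two_eq_span : (lcSeries K (FreeNilpotentTwo K 3) 2).toSubmodule =
    Submodule.span K {zz K 3 0, zz K 3 1} := by
  refine le_antisymm (fun x hx => ?_) (Submodule.span_le.2 ?_)
  · obtain ⟨α, β, u, hu, rfl⟩ := exists_eq_of_mem_lcSeries_two hx
    rw [lcSeries_eq_bot, LieSubmodule.mem_bot] at hu
    rw [hu, add_zero]
    exact Submodule.mem_span_pair.2 ⟨α, β, rfl⟩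
  · rintro x (rfl | rfl) <;> exact zz_mem _

theorem lcSeries_four_three_eq_span [CharZero K] :
    (lcSeries K (FreeNilpotentTwo K 4) 3).toSubmodule =
      Submodule.span K {xx₀ K 4, xx₁ K 4, xx₂ K 4} := by
  refine le_antisymm (fun x hx => ?_) (Submodule.span_le.2 ?_)
  · obtain ⟨α, β, γ, u, hu, rfl⟩ := exists_eq_of_mem_lcSeries_three hx
    rw [lcSeries_eq_bot, LieSubmodule.mem_bot] at hu
    rw [hu, add_zero]
    exact Submodule.mem_span_triple.2 ⟨α, β, γ, rfl⟩
  · rintro x (rfl | rfl | rfl)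
    exacts [xx_zero_mem, xx_one_mem, xx_two_mem]

theorem finrank_lcSeries_three_two :
    Module.finrank K (lcSeries K (FreeNilpotentTwo K 3) 2).toSubmodule = 2 := by
  have hli : LinearIndependent K ![zz K 3 0, zz K 3 1] := LinearIndependent.pair_iff.2 fun α β h =>
    eq_zero_of_smul_zz_mem le_rfl (h ▸ zero_mem _)
  have := finrank_span_eq_card hli
  rwa [Matrix.range_cons, Matrix.range_cons, Matrix.range_empty, Set.union_empty,
    ← Set.insert_eq, Fintype.card_fin, ← lcSeries_three_two_eq_span] at this

theorem finrank_lcSeries_four_three [CharZero K] :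
    Module.finrank K (lcSeries K (FreeNilpotentTwo K 4) 3).toSubmodule = 3 := by
  have hli : LinearIndependent K ![xx₀ K 4, xx₁ K 4, xx₂ K 4] := by
    refine Fintype.linearIndependent_iff.2 fun g hg => ?_
    rw [Fin.sum_univ_three] at hg
    obtain ⟨h0, h1, h2⟩ := eq_zero_of_smul_xx_eq_zero hg
    intro i
    fin_cases i <;> assumption
  have := finrank_span_eq_card hli
  rwa [Matrix.range_cons, Matrix.range_cons, Matrix.range_cons, Matrix.range_empty,
    Set.union_empty, ← Set.insert_eq, ← Set.insert_eq, Fintype.card_fin,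
    ← lcSeries_four_three_eq_span] at this

/-- A subspace between two terms of the lower central series that are two steps apart is an ideal
as soon as it is stable under the generators. -/
theorem exists_lieIdeal_of_lie_vv_mem {k : ℕ} {I : Submodule K (FreeNilpotentTwo K t)}
    (hI : I ≤ (lcSeries K (FreeNilpotentTwo K t) k).toSubmodule) (hk : t ≤ k + 2)
    (hv : ∀ i, ∀ x ∈ I, ⁅vv K t i, x⁆ ∈ I) :
    ∃ J : LieIdeal K (FreeNilpotentTwo K t), J.toSubmodule = I := by
  refine ⟨{ I with lie_mem := fun {y x} hx => ?_ }, rfl⟩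
  obtain ⟨α, β, u, hu, rfl⟩ := exists_sub_mem_lcSeries_one (span_vv_sup (K := K) (t := t)) y
  have h0 : ⁅u, x⁆ = 0 := by
    -- An element of the derived algebra pushes `I` down by two steps, hence to zero; only the
    -- generators act on `I`.
    have := lcSeries_anti (j := t) (by omega) (lie_mem_lcSeries_add hu (hI hx))
    rwa [lcSeries_eq_bot, LieSubmodule.mem_bot] at this
  rw [add_lie, add_lie, smul_lie, smul_lie, h0, add_zero]
  exact add_mem (I.smul_mem _ (hv 0 x hx)) (I.smul_mem _ (hv 1 x hx))

theorem lie_eq_zero_of_mem_last {k : ℕ} (hk : t ≤ k + 1) (y : FreeNilpotentTwo K t)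
    {x : FreeNilpotentTwo K t} (hx : x ∈ lcSeries K (FreeNilpotentTwo K t) k) : ⁅y, x⁆ = 0 := by
  have := lcSeries_anti (j := t) hk (lie_mem_lcSeries_succ y hx)
  rwa [lcSeries_eq_bot, LieSubmodule.mem_bot] at this

theorem exists_lieIdeal_of_le_last {k : ℕ} {I : Submodule K (FreeNilpotentTwo K t)}
    (hI : I ≤ (lcSeries K (FreeNilpotentTwo K t) k).toSubmodule) (hk : t ≤ k + 1) :
    ∃ J : LieIdeal K (FreeNilpotentTwo K t), J.toSubmodule = I :=
  exists_lieIdeal_of_lie_vv_mem hI (by omega) fun i x hx => by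
    rw [lie_eq_zero_of_mem_last hk _ (hI hx)]
    exact zero_mem _

/-- If an ideal contains `w₀` modulo `⁅L, ⁅L, L⁆⁆`, then it contains the derived algebra. -/
theorem lcSeries_one_le_of_ww_mem {J : LieIdeal K (FreeNilpotentTwo K t)}
    (h : ww K t ∈ J ⊔ lcSeries K (FreeNilpotentTwo K t) 2) :
    lcSeries K (FreeNilpotentTwo K t) 1 ≤ J := by
  refine lcSeries_le_of_le_sup (t := t) (fun x hx => ?_) (lcSeries_eq_bot.le.trans bot_le)
  obtain ⟨γ, u, hu, rfl⟩ := exists_eq_of_mem_lcSeries_one hx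
  exact add_mem (Submodule.smul_mem _ _ h) ((le_sup_right : _ ≤ J ⊔ _) hu)

theorem lcSeries_two_le_of_zz_mem {J : LieIdeal K (FreeNilpotentTwo K t)}
    (h : ∀ i, zz K t i ∈ J ⊔ lcSeries K (FreeNilpotentTwo K t) 3) :
    lcSeries K (FreeNilpotentTwo K t) 2 ≤ J := by
  refine lcSeries_le_of_le_sup (t := t) (fun x hx => ?_) (lcSeries_eq_bot.le.trans bot_le)
  obtain ⟨α, β, u, hu, rfl⟩ := exists_eq_of_mem_lcSeries_two hx
  exact add_mem (add_mem (Submodule.smul_mem _ _ (h 0)) (Submodule.smul_mem _ _ (h 1)))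
    ((le_sup_right : _ ≤ J ⊔ _) hu)

/-- A nonzero coefficient of `w₀` would put `w₀` in `J` modulo the third power, hence all of `𝔫^2`,
which contains `𝔫^t`, in `J`. -/
theorem le_lcSeries_two {J : LieIdeal K (FreeNilpotentTwo K t)} (ht : 2 ≤ t)
    (h1 : J ≤ lcSeries K (FreeNilpotentTwo K t) 1)
    (h2 : ¬ lcSeries K (FreeNilpotentTwo K t) (t - 1) ≤ J) :
    J ≤ lcSeries K (FreeNilpotentTwo K t) 2 := by
  intro x hx
  obtain ⟨γ, u, hu, rfl⟩ := exists_eq_of_mem_lcSeries_one (h1 hx)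
  by_cases hγ : γ = 0
  · simpa [hγ] using hu
  refine absurd ((lcSeries_anti (by omega)).trans (lcSeries_one_le_of_ww_mem ?_)) h2
  have : ww K t = γ⁻¹ • (γ • ww K t + u) + -(γ⁻¹ • u) := by
    rw [smul_add, smul_smul, inv_mul_cancel₀ hγ, one_smul, add_neg_cancel_right]
  rw [this]
  exact (LieSubmodule.mem_sup _ _ _).2
    ⟨_, Submodule.smul_mem _ _ hx, _, neg_mem (Submodule.smul_mem _ _ hu), rfl⟩

theorem not_lcSeries_le_of_isListedThree {J : LieIdeal K (FreeNilpotentTwo K 3)}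
    (hJ : IsListedThree K J.toSubmodule) : ¬ lcSeries K (FreeNilpotentTwo K 3) 2 ≤ J := by
  intro h
  have := finrank_lcSeries_three_two (K := K)
  rw [le_antisymm h hJ.1] at this
  have := hJ.2
  omega

theorem eq_bot_or_isListedThree {J : LieIdeal K (FreeNilpotentTwo K 3)}
    (h1 : J ≤ lcSeries K (FreeNilpotentTwo K 3) 1)
    (h2 : ¬ lcSeries K (FreeNilpotentTwo K 3) 2 ≤ J) : J = ⊥ ∨ IsListedThree K J.toSubmodule := by
  have := finiteDimensional (K := K) (t := 3) (by norm_num)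
  have h := le_lcSeries_two (by norm_num) h1 h2
  have hlt : Module.finrank K J.toSubmodule < 2 := by
    have := Submodule.finrank_lt_finrank_of_lt
      (show J.toSubmodule < (lcSeries K (FreeNilpotentTwo K 3) 2).toSubmodule from
        lt_of_le_not_ge h h2)
    rwa [finrank_lcSeries_three_two] at this
  obtain h0 | h0 : Module.finrank K J.toSubmodule = 0 ∨ Module.finrank K J.toSubmodule = 1 := by
    omega
  · left
    rwa [Submodule.finrank_eq_zero, LieSubmodule.toSubmodule_eq_bot] at h0
  · exact Or.inr ⟨h, h0⟩

/-- The ideals `span ⟨z₁ + α x₀, x₁, x₂⟩`. -/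
noncomputable abbrev familyOne (α : K) : Submodule K (FreeNilpotentTwo K 4) :=
  Submodule.span K {zz K 4 1 + α • xx₀ K 4, xx₁ K 4, xx₂ K 4}

/-- The ideals `span ⟨z₀ + α z₁ + β x₂, 2 x₀ + α x₁, x₁ + 2 α x₂⟩`. -/
noncomputable abbrev familyTwo (α β : K) : Submodule K (FreeNilpotentTwo K 4) :=
  Submodule.span K {zz K 4 0 + α • zz K 4 1 + β • xx₂ K 4, (2 : K) • xx₀ K 4 + α • xx₁ K 4,
    xx₁ K 4 + (2 * α) • xx₂ K 4}

theorem familyOne_le (α : K) :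
    familyOne α ≤ (lcSeries K (FreeNilpotentTwo K 4) 2).toSubmodule := by
  have h32 := lcSeries_anti (K := K) (L := FreeNilpotentTwo K 4) (show 2 ≤ 3 by norm_num)
  refine Submodule.span_le.2 ?_
  rintro x (rfl | rfl | rfl)
  exacts [add_mem (zz_mem 1) (Submodule.smul_mem _ _ (h32 xx_zero_mem)), h32 xx_one_mem,
    h32 xx_two_mem]

theorem familyTwo_le (α β : K) :
    familyTwo α β ≤ (lcSeries K (FreeNilpotentTwo K 4) 2).toSubmodule := by
  have h32 := lcSeries_anti (K := K) (L := FreeNilpotentTwo K 4) (show 2 ≤ 3 by norm_num)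
  refine Submodule.span_le.2 ?_
  rintro x (rfl | rfl | rfl)
  exacts [add_mem (add_mem (zz_mem 0) (Submodule.smul_mem _ _ (zz_mem 1)))
      (Submodule.smul_mem _ _ (h32 xx_two_mem)),
    add_mem (Submodule.smul_mem _ _ (h32 xx_zero_mem)) (Submodule.smul_mem _ _ (h32 xx_one_mem)),
    add_mem (h32 xx_one_mem) (Submodule.smul_mem _ _ (h32 xx_two_mem))]

theorem exists_lieIdeal_of_lie_vv_span {S : Set (FreeNilpotentTwo K 4)}
    (hS : Submodule.span K S ≤ (lcSeries K (FreeNilpotentTwo K 4) 2).toSubmodule)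
    (hv : ∀ i, ∀ x ∈ S, ⁅vv K 4 i, x⁆ ∈ Submodule.span K S) :
    ∃ J : LieIdeal K (FreeNilpotentTwo K 4), J.toSubmodule = Submodule.span K S := by
  refine exists_lieIdeal_of_lie_vv_mem hS le_rfl fun i x hx => ?_
  induction hx using Submodule.span_induction with
  | mem x hx => exact hv i x hx
  | zero => rw [lie_zero]; exact zero_mem _
  | add x y _ _ hx hy => rw [lie_add]; exact add_mem hx hy
  | smul c x _ hx => rw [lie_smul]; exact Submodule.smul_mem _ c hx

theorem lie_xx_zero (y : FreeNilpotentTwo K 4) : ⁅y, xx₀ K 4⁆ = 0 :=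
  lie_eq_zero_of_mem_last le_rfl y xx_zero_mem

theorem lie_xx_one (y : FreeNilpotentTwo K 4) : ⁅y, xx₁ K 4⁆ = 0 :=
  lie_eq_zero_of_mem_last le_rfl y xx_one_mem

theorem lie_xx_two (y : FreeNilpotentTwo K 4) : ⁅y, xx₂ K 4⁆ = 0 :=
  lie_eq_zero_of_mem_last le_rfl y xx_two_mem

theorem exists_lieIdeal_of_isListedThree {I : Submodule K (FreeNilpotentTwo K 3)}
    (hI : IsListedThree K I) : ∃ J : LieIdeal K (FreeNilpotentTwo K 3), J.toSubmodule = I :=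
  exists_lieIdeal_of_le_last hI.1 le_rfl

theorem isListedFour_le {I : Submodule K (FreeNilpotentTwo K 4)} (hI : IsListedFour K I) :
    I ≤ (lcSeries K (FreeNilpotentTwo K 4) 2).toSubmodule := by
  rcases hI with hI | ⟨α, rfl⟩ | ⟨α, β, rfl⟩
  · exact hI.1.trans (lcSeries_anti (show 2 ≤ 3 by norm_num))
  · exact familyOne_le α
  · exact familyTwo_le α β

section CharZero

variable [CharZero K]

theorem lie_vv_zz_cross (K : Type u) [Field K] [CharZero K] (t : ℕ) :
    ⁅vv K t 0, zz K t 1⁆ = (2 : K)⁻¹ • xx₁ K t := by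
  rw [xx₁, smul_smul, inv_mul_cancel₀ two_ne_zero, one_smul]

theorem exists_lieIdeal_familyOne (α : K) :
    ∃ J : LieIdeal K (FreeNilpotentTwo K 4), J.toSubmodule = familyOne α := by
  refine exists_lieIdeal_of_lie_vv_span (familyOne_le α) fun i x hx => ?_
  rcases hx with rfl | rfl | rfl
  · rw [lie_add, lie_smul, lie_xx_zero, smul_zero, add_zero]
    fin_cases i
    · change ⁅vv K 4 0, zz K 4 1⁆ ∈ _
      rw [lie_vv_zz_cross]
      exact Submodule.smul_mem _ _ (Submodule.subset_span (by simp))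
    · exact Submodule.subset_span (by simp [xx₂])
  · rw [lie_xx_one]; exact zero_mem _
  · rw [lie_xx_two]; exact zero_mem _

theorem exists_lieIdeal_familyTwo (α β : K) :
    ∃ J : LieIdeal K (FreeNilpotentTwo K 4), J.toSubmodule = familyTwo α β := by
  refine exists_lieIdeal_of_lie_vv_span (familyTwo_le α β) fun i x hx => ?_
  rcases hx with rfl | rfl | rfl
  · rw [lie_add, lie_add, lie_smul, lie_smul, lie_xx_two, smul_zero, add_zero]
    fin_cases i
    · change ⁅vv K 4 0, zz K 4 0⁆ + α • ⁅vv K 4 0, zz K 4 1⁆ ∈ _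
      have : ⁅vv K 4 0, zz K 4 0⁆ + α • ⁅vv K 4 0, zz K 4 1⁆ =
          (2 : K)⁻¹ • ((2 : K) • xx₀ K 4 + α • xx₁ K 4) := by
        rw [lie_vv_zz_cross, smul_add, smul_smul (2 : K)⁻¹ 2, inv_mul_cancel₀ two_ne_zero, one_smul,
          smul_comm, xx₀]
      rw [this]
      exact Submodule.smul_mem _ _ (Submodule.subset_span (by simp))
    · change ⁅vv K 4 1, zz K 4 0⁆ + α • ⁅vv K 4 1, zz K 4 1⁆ ∈ _
      have : ⁅vv K 4 1, zz K 4 0⁆ + α • ⁅vv K 4 1, zz K 4 1⁆ =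
          (2 : K)⁻¹ • (xx₁ K 4 + (2 * α) • xx₂ K 4) := by
        rw [vv_lie_xx, lie_vv_zz_cross, smul_add, smul_smul, ← mul_assoc,
          inv_mul_cancel₀ two_ne_zero, one_mul, xx₂]
      rw [this]
      exact Submodule.smul_mem _ _ (Submodule.subset_span (by simp))
  · rw [lie_add, lie_smul, lie_smul, lie_xx_one, lie_xx_zero, smul_zero, smul_zero, add_zero]
    exact zero_mem _
  · rw [lie_add, lie_smul, lie_xx_one, lie_xx_two, smul_zero, add_zero]
    exact zero_mem _

/-- With `xx_two_notMem_familyTwo`, this shows that the quotients by the two families still have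
nilindex 4. The coefficient of the generator involving a `z` is killed modulo `𝔫^4`; independence of
the `x`'s does the rest. -/
theorem xx_zero_notMem_familyOne (α : K) : xx₀ K 4 ∉ familyOne α := by
  intro h
  obtain ⟨a, b, c, h⟩ := Submodule.mem_span_triple.1 h
  have ha : a = 0 := by
    refine (eq_zero_of_smul_zz_mem (K := K) (t := 4) (α := 0) (by norm_num) (?_)).2
    have e : (0 : K) • zz K 4 0 + a • zz K 4 1 =
        xx₀ K 4 - (a * α) • xx₀ K 4 - b • xx₁ K 4 - c • xx₂ K 4 := by
      linear_combination (norm := module) h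
    rw [e]
    exact sub_mem (sub_mem (sub_mem xx_zero_mem (Submodule.smul_mem _ _ xx_zero_mem))
      (Submodule.smul_mem _ _ xx_one_mem)) (Submodule.smul_mem _ _ xx_two_mem)
  subst ha
  have := eq_zero_of_smul_xx_eq_zero (K := K) (α := -1) (β := b) (γ := c) (by
    rw [← sub_eq_zero] at h
    rw [← h]; module)
  simpa using this.1

theorem xx_two_notMem_familyTwo (α β : K) : xx₂ K 4 ∉ familyTwo α β := by
  intro h
  obtain ⟨a, b, c, h⟩ := Submodule.mem_span_triple.1 h
  have ha : a = 0 := by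
    refine (eq_zero_of_smul_zz_mem (K := K) (t := 4) (β := a * α) (by norm_num) (?_)).1
    have e : a • zz K 4 0 + (a * α) • zz K 4 1 =
        (1 - a * β - c * (2 * α)) • xx₂ K 4 - (b * 2) • xx₀ K 4 - (b * α + c) • xx₁ K 4 := by
      linear_combination (norm := module) h
    rw [e]
    exact sub_mem (sub_mem (Submodule.smul_mem _ _ xx_two_mem)
      (Submodule.smul_mem _ _ xx_zero_mem)) (Submodule.smul_mem _ _ xx_one_mem)
  subst ha
  obtain ⟨h0, h1, h2⟩ := eq_zero_of_smul_xx_eq_zero (K := K) (α := b * 2) (β := b * α + c)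
    (γ := c * (2 * α) - 1) (by
      linear_combination (norm := module) h)
  have hb : b = 0 := by simpa using h0
  subst hb
  have hc : c = 0 := by simpa using h1
  subst hc
  simp at h2

theorem exists_lieIdeal_of_isListedFour {I : Submodule K (FreeNilpotentTwo K 4)}
    (hI : IsListedFour K I) : ∃ J : LieIdeal K (FreeNilpotentTwo K 4), J.toSubmodule = I := by
  rcases hI with hI | ⟨α, rfl⟩ | ⟨α, β, rfl⟩
  · exact exists_lieIdeal_of_le_last (k := 3) hI.1 le_rfl
  · exact exists_lieIdeal_familyOne α
  · exact exists_lieIdeal_familyTwo α β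

theorem not_lcSeries_le_of_isListedFour {I : Submodule K (FreeNilpotentTwo K 4)}
    (hI : IsListedFour K I) : ¬ (lcSeries K (FreeNilpotentTwo K 4) 3).toSubmodule ≤ I := by
  intro h
  rcases hI with hI | ⟨α, rfl⟩ | ⟨α, β, rfl⟩
  · have := finrank_lcSeries_four_three (K := K)
    rw [le_antisymm h hI.1] at this
    have := hI.2
    omega
  · exact xx_zero_notMem_familyOne α (h xx_zero_mem)
  · exact xx_two_notMem_familyTwo α β (h xx_two_mem)

theorem isListedFour_ne_bot {I : Submodule K (FreeNilpotentTwo K 4)} (hI : IsListedFour K I) :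
    I ≠ ⊥ := by
  rintro rfl
  rcases hI with ⟨-, h⟩ | ⟨α, h⟩ | ⟨α, β, h⟩
  · simp at h
  · have h0 : xx₁ K 4 = 0 := (Submodule.mem_bot K).1 (h ▸ Submodule.subset_span (by simp))
    have := eq_zero_of_smul_xx_eq_zero (K := K) (α := 0) (β := 1) (γ := 0) (by simp [h0])
    simp at this
  · have h0 : xx₁ K 4 + (2 * α) • xx₂ K 4 = 0 :=
      (Submodule.mem_bot K).1 (h ▸ Submodule.subset_span (by simp))
    have := eq_zero_of_smul_xx_eq_zero (K := K) (α := 0) (β := 1) (γ := 2 * α) (by simp [h0])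
    simp at this

/-- Outside `𝔫^4`, the ideal `J` is determined by an element `p` with a nonzero `z`-part: the
brackets of `p` with the generators already give the largest `J ∩ 𝔫^4` allowed, and modulo `𝔫^4`
there is room only for the line of `p`. -/
theorem eq_bot_or_isListedFour {J : LieIdeal K (FreeNilpotentTwo K 4)}
    (h1 : J ≤ lcSeries K (FreeNilpotentTwo K 4) 1)
    (hJ : ¬ lcSeries K (FreeNilpotentTwo K 4) 3 ≤ J) : J = ⊥ ∨ IsListedFour K J.toSubmodule := by
  have := finiteDimensional (K := K) (t := 4) (by norm_num)
  have h2 := le_lcSeries_two (by norm_num) h1 hJ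
  by_cases h3 : J ≤ lcSeries K (FreeNilpotentTwo K 4) 3
  · have hlt : Module.finrank K J.toSubmodule < 3 := by
      have := Submodule.finrank_lt_finrank_of_lt
        (show J.toSubmodule < (lcSeries K (FreeNilpotentTwo K 4) 3).toSubmodule from
          lt_of_le_not_ge h3 hJ)
      rwa [finrank_lcSeries_four_three] at this
    obtain h0 | h0 : Module.finrank K J.toSubmodule = 0 ∨
      (Module.finrank K J.toSubmodule = 1 ∨ Module.finrank K J.toSubmodule = 2) := by omega
    · left
      rwa [Submodule.finrank_eq_zero, LieSubmodule.toSubmodule_eq_bot] at h0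
    · exact Or.inr (Or.inl ⟨h3, h0⟩)
  right
  have hz : ¬ ∀ i, zz K 4 i ∈ J ⊔ lcSeries K (FreeNilpotentTwo K 4) 3 := fun h =>
    hJ ((lcSeries_anti (by norm_num)).trans (lcSeries_two_le_of_zz_mem h))
  have hx : ¬ (xx₀ K 4 ∈ J ∧ xx₁ K 4 ∈ J ∧ xx₂ K 4 ∈ J) := by
    rintro ⟨x0, x1, x2⟩
    refine hJ ?_
    change (lcSeries K (FreeNilpotentTwo K 4) 3).toSubmodule ≤ J.toSubmodule
    rw [lcSeries_four_three_eq_span, Submodule.span_le]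
    rintro x (rfl | rfl | rfl) <;> assumption
  have hform : ∀ y ∈ J, ∃ a b c d e : K, y = a • zz K 4 0 + b • zz K 4 1 +
      (c • xx₀ K 4 + d • xx₁ K 4 + e • xx₂ K 4) := by
    intro y hy
    obtain ⟨a, b, u, hu, rfl⟩ := exists_eq_of_mem_lcSeries_two (h2 hy)
    obtain ⟨c, d, e, v, hv, rfl⟩ := exists_eq_of_mem_lcSeries_three hu
    rw [lcSeries_eq_bot, LieSubmodule.mem_bot] at hv
    exact ⟨a, b, c, d, e, by rw [hv, add_zero]⟩
  obtain ⟨p, hpJ, hp3⟩ := SetLike.not_le_iff_exists.1 h3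
  obtain ⟨a, b, c, d, e, rfl⟩ := hform p hpJ
  have hx3 : ∀ c d e : K, c • xx₀ K 4 + d • xx₁ K 4 + e • xx₂ K 4 ∈
      lcSeries K (FreeNilpotentTwo K 4) 3 := fun c d e =>
    add_mem (add_mem (Submodule.smul_mem _ _ xx_zero_mem) (Submodule.smul_mem _ _ xx_one_mem))
      (Submodule.smul_mem _ _ xx_two_mem)
  have hsup : ∀ z c d e, z + (c • xx₀ K 4 + d • xx₁ K 4 + e • xx₂ K 4) ∈ J →
      z ∈ J ⊔ lcSeries K (FreeNilpotentTwo K 4) 3 := fun z c d e h => by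
    refine (LieSubmodule.mem_sup _ _ _).2 ⟨_, h, _, neg_mem (hx3 c d e), ?_⟩
    abel
  -- The `x`-part of `p` is central, so these brackets see only `a z₀ + b z₁`.
  have hv : ∀ i, a • ⁅vv K 4 i, zz K 4 0⁆ + b • ⁅vv K 4 i, zz K 4 1⁆ ∈ J := fun i => by
    have := lie_mem_right K _ J (vv K 4 i) _ hpJ
    simpa only [lie_add, lie_smul, lie_xx_zero, lie_xx_one, lie_xx_two, smul_zero, add_zero]
      using this
  have hv0 : a • xx₀ K 4 + (b / 2) • xx₁ K 4 ∈ J := by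
    have := hv 0
    rwa [lie_vv_zz_cross, smul_smul, ← div_eq_mul_inv] at this
  have hv1 : (a / 2) • xx₁ K 4 + b • xx₂ K 4 ∈ J := by
    have := hv 1
    rwa [vv_lie_xx, lie_vv_zz_cross, smul_smul, ← div_eq_mul_inv] at this
  have hinv : ∀ {N : LieIdeal K (FreeNilpotentTwo K 4)} {r : K} {x : FreeNilpotentTwo K 4},
      r ≠ 0 → r • x ∈ N → x ∈ N := fun {N r x} hr h =>
    (Submodule.smul_mem_iff N.toSubmodule hr).1 h
  have hsupp := hsup _ c d e hpJ
  by_cases ha : a = 0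
  · subst ha
    have hb : b ≠ 0 := by
      rintro rfl
      exact hp3 (by simpa using hx3 c d e)
    rw [zero_smul, zero_add] at hv0 hsupp
    rw [zero_div, zero_smul, zero_add] at hv1
    have hx1 := hinv (div_ne_zero hb two_ne_zero) hv0
    have hx2 := hinv hb hv1
    have hz1 := hinv hb hsupp
    -- Since `x₁` and `x₂` lie in `J`, they can be removed from `b⁻¹ p`; the remaining coefficient
    -- `c / b` of `x₀` is the parameter of the family.
    have hq : zz K 4 1 + (c / b) • xx₀ K 4 ∈ J := by
      have e1 : zz K 4 1 + (c / b) • xx₀ K 4 = b⁻¹ • ((0 : K) • zz K 4 0 + b • zz K 4 1 +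
          (c • xx₀ K 4 + d • xx₁ K 4 + e • xx₂ K 4)) - (d / b) • xx₁ K 4 - (e / b) • xx₂ K 4 := by
        match_scalars <;> field_simp <;> ring
      rw [e1]
      exact sub_mem (sub_mem (Submodule.smul_mem _ _ hpJ) (Submodule.smul_mem _ _ hx1))
        (Submodule.smul_mem _ _ hx2)
    refine Or.inr (Or.inl ⟨c / b, le_antisymm (fun y hy => ?_) (Submodule.span_le.2 ?_)⟩)
    · obtain ⟨a', b', c', d', e', rfl⟩ := hform y hy
      have ha' : a' = 0 := by
        by_contra ha'
        refine hz fun i => ?_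
        have h0 := sub_mem (hsup _ _ _ _ hy) (Submodule.smul_mem _ b' hz1)
        rw [add_sub_cancel_right] at h0
        fin_cases i
        exacts [hinv ha' h0, hz1]
      subst ha'
      -- Otherwise `x₀ ∈ J`, and then `𝔫^4 ⊆ J`.
      have hc' : c' - b' * (c / b) = 0 := by
        by_contra hc'
        refine hx ⟨hinv hc' ?_, hx1, hx2⟩
        have e1 : (c' - b' * (c / b)) • xx₀ K 4 = ((0 : K) • zz K 4 0 + b' • zz K 4 1 +
          (c' • xx₀ K 4 + d' • xx₁ K 4 + e' • xx₂ K 4)) - b' • (zz K 4 1 + (c / b) • xx₀ K 4) -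
            d' • xx₁ K 4 - e' • xx₂ K 4 := by module
        rw [e1]
        exact sub_mem (sub_mem (sub_mem hy (Submodule.smul_mem _ _ hq))
          (Submodule.smul_mem _ _ hx1)) (Submodule.smul_mem _ _ hx2)
      refine Submodule.mem_span_triple.2 ⟨b', d', e', ?_⟩
      rw [sub_eq_zero] at hc'
      rw [hc']
      module
    · rintro x (rfl | rfl | rfl) <;> assumption
  · have hg1 : (2 : K) • xx₀ K 4 + (b / a) • xx₁ K 4 ∈ J := by
      have e1 : (2 : K) • xx₀ K 4 + (b / a) • xx₁ K 4 =
          (2 / a) • (a • xx₀ K 4 + (b / 2) • xx₁ K 4) := by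
        match_scalars <;> field_simp
      rw [e1]
      exact Submodule.smul_mem _ _ hv0
    have hg2 : xx₁ K 4 + (2 * (b / a)) • xx₂ K 4 ∈ J := by
      have e1 : xx₁ K 4 + (2 * (b / a)) • xx₂ K 4 =
          (2 / a) • ((a / 2) • xx₁ K 4 + b • xx₂ K 4) := by
        match_scalars <;> field_simp
      rw [e1]
      exact Submodule.smul_mem _ _ hv1
    obtain ⟨β, hq⟩ : ∃ β : K, zz K 4 0 + (b / a) • zz K 4 1 + β • xx₂ K 4 ∈ J := by
      -- From `a⁻¹ p`, the element of `hg1` removes `x₀` and then that of `hg2` removes `x₁`; this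
      -- is what is left at `x₂`.
      refine ⟨e / a - 2 * (b / a) * (d / a - b / a * (c / a) / 2), ?_⟩
      have e1 : zz K 4 0 + (b / a) • zz K 4 1 +
          (e / a - 2 * (b / a) * (d / a - b / a * (c / a) / 2)) • xx₂ K 4 =
          a⁻¹ • (a • zz K 4 0 + b • zz K 4 1 + (c • xx₀ K 4 + d • xx₁ K 4 + e • xx₂ K 4)) -
            (c / a / 2) • ((2 : K) • xx₀ K 4 + (b / a) • xx₁ K 4) -
            (d / a - b / a * (c / a) / 2) • (xx₁ K 4 + (2 * (b / a)) • xx₂ K 4) := by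
        match_scalars <;> field_simp <;> ring
      rw [e1]
      exact sub_mem (sub_mem (Submodule.smul_mem _ _ hpJ) (Submodule.smul_mem _ _ hg1))
        (Submodule.smul_mem _ _ hg2)
    generalize b / a = α at hg1 hg2 hq
    -- The generators `hg1`, `hg2` are triangular in the `x`'s, so `x₂ ∈ J` would give `x₁` and then
    -- `x₀`.
    have hx2 : xx₂ K 4 ∉ J := fun hx2 => by
      have hx1 : xx₁ K 4 ∈ J := by
        simpa using sub_mem hg2 (Submodule.smul_mem J.toSubmodule (2 * α) hx2)
      refine hx ⟨hinv (two_ne_zero (α := K)) ?_, hx1, hx2⟩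
      simpa using sub_mem hg1 (Submodule.smul_mem J.toSubmodule α hx1)
    refine Or.inr (Or.inr ⟨α, β, le_antisymm (fun y hy => ?_) (Submodule.span_le.2 ?_)⟩)
    · obtain ⟨a', b', c', d', e', rfl⟩ := hform y hy
      have hqs : zz K 4 0 + α • zz K 4 1 ∈ J ⊔ lcSeries K (FreeNilpotentTwo K 4) 3 :=
        hsup _ 0 0 β (by simpa using hq)
      have hb' : b' - a' * α = 0 := by
        by_contra hb'
        have hz1 : zz K 4 1 ∈ J ⊔ lcSeries K (FreeNilpotentTwo K 4) 3 := by
          refine hinv hb' ?_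
          have e1 : (b' - a' * α) • zz K 4 1 = (a' • zz K 4 0 + b' • zz K 4 1) -
            a' • (zz K 4 0 + α • zz K 4 1) := by module
          rw [e1]
          exact sub_mem (hsup _ _ _ _ hy) (Submodule.smul_mem _ _ hqs)
        refine hz fun i => ?_
        fin_cases i
        · simpa using sub_mem hqs (Submodule.smul_mem (LieSubmodule.toSubmodule _) α hz1)
        · exact hz1
      rw [sub_eq_zero] at hb'
      subst hb'
      -- Reducing an element of `J` by the three generators leaves this multiple of `x₂`, which is
      -- not in `J`.
      have he' : e' - a' * β - 2 * α * (d' - α * c' / 2) = 0 := by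
        by_contra he'
        refine hx2 (hinv he' ?_)
        have e1 : (e' - a' * β - 2 * α * (d' - α * c' / 2)) • xx₂ K 4 =
            (a' • zz K 4 0 + (a' * α) • zz K 4 1 +
              (c' • xx₀ K 4 + d' • xx₁ K 4 + e' • xx₂ K 4)) -
            a' • (zz K 4 0 + α • zz K 4 1 + β • xx₂ K 4) -
            (c' / 2) • ((2 : K) • xx₀ K 4 + α • xx₁ K 4) -
            (d' - α * c' / 2) • (xx₁ K 4 + (2 * α) • xx₂ K 4) := by
          match_scalars <;> field_simp <;> ring
        rw [e1]
        exact sub_mem (sub_mem (sub_mem hy (Submodule.smul_mem _ _ hq))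
          (Submodule.smul_mem _ _ hg1)) (Submodule.smul_mem _ _ hg2)
      refine Submodule.mem_span_triple.2 ⟨a', c' / 2, d' - α * c' / 2, ?_⟩
      have he'' : e' = a' * β + 2 * α * (d' - α * c' / 2) := by linear_combination he'
      rw [he'']
      match_scalars <;> field_simp <;> ring
    · rintro x (rfl | rfl | rfl) <;> assumption

end CharZero

end FreeNilpotentTwo

/-! ### Derivations of the free Lie algebra and the action of `𝔰𝔩₂` -/

section Derivations

variable {K : Type u} [Field K]

section

variable {L : Type v} [LieRing L] [LieAlgebra K L]

theorem LieDerivation.apply_mem_lcSeries (D : LieDerivation K L L) {k : ℕ} {x : L}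
    (hx : x ∈ lcSeries K L k) : D x ∈ lcSeries K L k := by
  induction k generalizing x with
  | zero => exact mem_lcSeries_zero _
  | succ k ih =>
    refine lcSeries_succ_induction (p := fun x => D x ∈ lcSeries K L (k + 1)) (by simp)
      (fun x y hx hy => ?_) (fun c x hx => ?_) (fun x y hy => ?_) hx
    · rw [map_add]; exact add_mem hx hy
    · rw [map_smul]; exact Submodule.smul_mem _ c hx
    · rw [LieDerivation.apply_lie_eq_add]
      exact add_mem (lie_mem_lcSeries_succ x (ih hy)) (lie_mem_lcSeries_succ _ hy)

/-- The derivation of a quotient induced by a derivation preserving the ideal. -/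
def LieDerivation.quot (I : LieIdeal K L) (D : LieDerivation K L L) (h : ∀ x ∈ I, D x ∈ I) :
    LieDerivation K (L ⧸ I) (L ⧸ I) where
  toLinearMap := I.toSubmodule.mapQ I.toSubmodule (D : L →ₗ[K] L) h
  leibniz' x y := by
    obtain ⟨x, rfl⟩ := I.quotHom_surjective x
    obtain ⟨y, rfl⟩ := I.quotHom_surjective y
    have key : ∀ z, I.toSubmodule.mapQ I.toSubmodule (D : L →ₗ[K] L) h (I.quotHom z) =
      I.quotHom (D z) := fun z => rfl
    rw [← LieHom.map_lie, key, key, key, ← LieHom.map_lie, ← LieHom.map_lie, ← map_sub,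
      LieDerivation.apply_lie_eq_sub]

theorem LieDerivation.quot_quotHom (I : LieIdeal K L) (D : LieDerivation K L L)
    (h : ∀ x ∈ I, D x ∈ I) (x : L) : D.quot I h (I.quotHom x) = I.quotHom (D x) := rfl

end

namespace FreeLieAlgebra

variable {X : Type*}

theorem lieSpan_range_of : LieSubalgebra.lieSpan K (FreeLieAlgebra K X)
    (Set.range (FreeLieAlgebra.of K)) = ⊤ :=
  eq_top_of_of_mem fun i => LieSubalgebra.subset_lieSpan ⟨i, rfl⟩

theorem derivation_ext {D₁ D₂ : LieDerivation K (FreeLieAlgebra K X) (FreeLieAlgebra K X)}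
    (h : ∀ i, D₁ (of K i) = D₂ (of K i)) : D₁ = D₂ :=
  LieDerivation.ext_of_lieSpan_eq_top _ lieSpan_range_of (by rintro _ ⟨i, rfl⟩; exact h i)

open LieModule.Cohomology LieAlgebra in
/-- The homomorphism to the split extension of the free Lie algebra by its adjoint module whose
second component is the derivation with given values on the generators. -/
noncomputable def derivationAux (f : X → FreeLieAlgebra K X) : FreeLieAlgebra K X →ₗ⁅K⁆
    ofTwoCocycle (0 : twoCocycle K (FreeLieAlgebra K X) (FreeLieAlgebra K X)) :=
  lift K fun i => ofProd _ (of K i, f i)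

open LieModule.Cohomology LieAlgebra in
-- The first component is an endomorphism fixing the generators. Knowing that it is the identity
-- turns multiplicativity of `derivationAux` into the Leibniz rule for the second component.
theorem derivationAux_fst (f : X → FreeLieAlgebra K X) (x : FreeLieAlgebra K X) :
    ((ofProd _).symm (derivationAux f x)).1 = x := by
  let g : FreeLieAlgebra K X →ₗ⁅K⁆ FreeLieAlgebra K X :=
    { toFun := fun x => ((ofProd _).symm (derivationAux f x)).1
      map_add' := fun x y => by simp
      map_smul' := fun c x => by simp
      map_lie' := fun {x y} => by simp [bracket_ofTwoCocycle] }
  have hg : g = LieHom.id := by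
    ext i
    simp [g, derivationAux]
  exact LieHom.congr_fun hg x

open LieModule.Cohomology LieAlgebra in
/-- The derivation of the free Lie algebra with given values on the generators. -/
noncomputable def derivation (f : X → FreeLieAlgebra K X) :
    LieDerivation K (FreeLieAlgebra K X) (FreeLieAlgebra K X) where
  toFun x := ((ofProd _).symm (derivationAux f x)).2
  map_add' x y := by simp
  map_smul' c x := by simp
  leibniz' x y := by
    change ((ofProd _).symm (derivationAux f ⁅x, y⁆)).2 =
      ⁅x, ((ofProd _).symm (derivationAux f y)).2⁆ - ⁅y, ((ofProd _).symm (derivationAux f x)).2⁆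
    simp [bracket_ofTwoCocycle, derivationAux_fst]

open LieModule.Cohomology LieAlgebra in
theorem derivation_of (f : X → FreeLieAlgebra K X) (i : X) : derivation f (of K i) = f i := by
  change ((ofProd _).symm (derivationAux f (of K i))).2 = f i
  simp [derivationAux]

end FreeLieAlgebra

/-- The derivation of the free Lie algebra on two generators extending a linear endomorphism of the
span of the generators. -/
noncomputable def matrixDerivation (M : Matrix (Fin 2) (Fin 2) K) :
    LieDerivation K (FreeLieTwo K) (FreeLieTwo K) :=
  FreeLieAlgebra.derivation fun j => M 0 j • freeGen K 0 + M 1 j • freeGen K 1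

theorem matrixDerivation_freeGen (M : Matrix (Fin 2) (Fin 2) K) (j : Fin 2) :
    matrixDerivation M (freeGen K j) = M 0 j • freeGen K 0 + M 1 j • freeGen K 1 :=
  FreeLieAlgebra.derivation_of _ _

open LieAlgebra.SpecialLinear

/-- The action of `𝔰𝔩₂` on the free Lie algebra on two generators. -/
noncomputable def slFreeDerivation : sl (Fin 2) K →ₗ⁅K⁆
    LieDerivation K (FreeLieTwo K) (FreeLieTwo K) where
  toFun M := matrixDerivation M.1
  map_add' M N := FreeLieAlgebra.derivation_ext fun i => by
    simp only [LieDerivation.add_apply, matrixDerivation_freeGen]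
    simp; module
  map_smul' c M := FreeLieAlgebra.derivation_ext fun i => by
    simp only [LieDerivation.smul_apply, matrixDerivation_freeGen]
    simp; module
  -- The images of the generators are the columns of the matrix, so composition follows matrix
  -- multiplication without reversal.
  map_lie' {M N} := FreeLieAlgebra.derivation_ext fun i => by
    simp only [LieDerivation.lie_apply, matrixDerivation_freeGen, map_add, map_smul, sl_bracket,
      Matrix.sub_apply, Matrix.mul_apply, Fin.sum_univ_two]
    module

/-- The action of `𝔰𝔩₂` on the free nilpotent Lie algebra on two generators. -/
noncomputable def slDerivation (t : ℕ) : sl (Fin 2) K →ₗ⁅K⁆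
    LieDerivation K (FreeNilpotentTwo K t) (FreeNilpotentTwo K t) where
  toFun M := (slFreeDerivation M).quot _ fun _ hx => (slFreeDerivation M).apply_mem_lcSeries hx
  map_add' M N := by
    ext x
    obtain ⟨x, rfl⟩ := FreeNilpotentTwo.proj_surjective K t x
    rw [LieDerivation.add_apply]
    simp only [FreeNilpotentTwo.proj, LieDerivation.quot_quotHom, map_add, LieDerivation.add_apply]
  map_smul' c M := by
    ext x
    obtain ⟨x, rfl⟩ := FreeNilpotentTwo.proj_surjective K t x
    rw [LieDerivation.smul_apply]
    simp only [FreeNilpotentTwo.proj, LieDerivation.quot_quotHom, map_smul,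
      LieDerivation.smul_apply, RingHom.id_apply]
  map_lie' {M N} := by
    ext x
    obtain ⟨x, rfl⟩ := FreeNilpotentTwo.proj_surjective K t x
    rw [LieDerivation.lie_apply]
    simp only [FreeNilpotentTwo.proj, LieDerivation.quot_quotHom, LieHom.map_lie,
      LieDerivation.lie_apply, map_sub]

theorem slDerivation_vv (t : ℕ) (M : sl (Fin 2) K) (j : Fin 2) :
    slDerivation t M (FreeNilpotentTwo.vv K t j) =
      M.1 0 j • FreeNilpotentTwo.vv K t 0 + M.1 1 j • FreeNilpotentTwo.vv K t 1 := by
  change FreeNilpotentTwo.proj K t (matrixDerivation M.1 (freeGen K j)) = _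
  rw [matrixDerivation_freeGen, map_add, map_smul, map_smul]
  rfl

end Derivations

/-! ### Existence: the semidirect product with `𝔰𝔩₂` -/

section LeviExtension

variable {K : Type u} [Field K] [CharZero K]

open LieAlgebra LieAlgebra.SpecialLinear

/-- An element `x` of an abelian ideal satisfies `[x, [y, x]] = 0` for every `y`. With `y` the two
off-diagonal matrix units, this kills the off-diagonal entries of `x` and makes the diagonal ones
equal; trace zero finishes. -/
theorem hasTrivialRadical_sl_two : HasTrivialRadical K (sl (Fin 2) K) := by
  rw [hasTrivialRadical_iff_no_abelian_ideals]
  intro I hI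
  rw [LieSubmodule.eq_bot_iff]
  intro x hx
  have key : ∀ y : sl (Fin 2) K, ⁅x, ⁅y, x⁆⁆ = 0 := fun y => by
    have h := hI.trivial ⟨x, hx⟩ ⟨⁅y, x⁆, lie_mem_right K _ I y x hx⟩
    exact congrArg Subtype.val h
  have hkey : ∀ y : sl (Fin 2) K, x.1 * (y.1 * x.1 - x.1 * y.1) -
      (y.1 * x.1 - x.1 * y.1) * x.1 = 0 := fun y => by
    have := congrArg Subtype.val (key y)
    rwa [sl_bracket, sl_bracket] at this
  have htr : x.1 0 0 + x.1 1 1 = 0 := by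
    have : x.1.trace = 0 := x.2
    rwa [Matrix.trace_fin_two] at this
  have he := hkey (single 0 1 (by decide) 1)
  have hf := hkey (single 1 0 (by decide) 1)
  rw [val_single] at he hf
  have he10 := congrFun (congrFun he 1) 0
  have hf01 := congrFun (congrFun hf 0) 1
  have hf10 := congrFun (congrFun hf 1) 0
  simp [Matrix.sub_apply, Matrix.mul_apply, Fin.sum_univ_two, Matrix.single] at he10 hf01 hf10
  have hd : x.1 0 0 = x.1 1 1 := by
    rw [he10, hf01] at hf10
    have : (x.1 0 0 - x.1 1 1) ^ 2 = 0 := by linear_combination -hf10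
    exact sub_eq_zero.1 (pow_eq_zero_iff two_ne_zero |>.1 this)
  have h11 : x.1 1 1 = 0 := by
    rw [hd, ← two_mul] at htr
    simpa using htr
  apply Subtype.ext
  ext i j
  fin_cases i <;> fin_cases j
  exacts [hd.trans h11, hf01, he10, h11]

/-- In characteristic 0 the condition is nondegeneracy of the Killing form, which is transported by
isomorphisms. -/
theorem LieAlgebra.HasTrivialRadical.of_equiv {L L' : Type*} [LieRing L] [LieAlgebra K L]
    [LieRing L'] [LieAlgebra K L'] [FiniteDimensional K L] [HasTrivialRadical K L]
    (e : L ≃ₗ⁅K⁆ L') : HasTrivialRadical K L' := by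
  have : FiniteDimensional K L' := Module.Finite.equiv e.toLinearEquiv
  have := LieAlgebra.isKilling_of_equiv e
  infer_instance

variable {N s : Type*} [LieRing N] [LieAlgebra K N] [LieRing s] [LieAlgebra K s]
  (ψ : s →ₗ⁅K⁆ LieDerivation K N N)

instance LieAlgebra.SemiDirectSum.instFiniteDimensional [FiniteDimensional K N]
    [FiniteDimensional K s] : FiniteDimensional K (N ⋊⁅ψ⁆ s) :=
  Module.Finite.equiv (SemiDirectSum.toProdl ψ).symm

omit [CharZero K] in
-- The radical maps onto a solvable ideal of `s`, which is zero; conversely the kernel is the image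
-- of the solvable `N`.
theorem LieAlgebra.radical_semiDirectSum [FiniteDimensional K N] [FiniteDimensional K s]
    [IsSolvable N] [HasTrivialRadical K s] :
    radical K (N ⋊⁅ψ⁆ s) = (SemiDirectSum.projr ψ).ker := by
  refine le_antisymm (fun x hx => ?_) ?_
  · let I := (radical K (N ⋊⁅ψ⁆ s)).map (SemiDirectSum.projr ψ)
    let f : radical K (N ⋊⁅ψ⁆ s) →ₗ⁅K⁆ I :=
      { toFun := fun y => ⟨SemiDirectSum.projr ψ y, LieIdeal.mem_map y.2⟩
        map_add' := fun _ _ => rfl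
        map_smul' := fun _ _ => rfl
        map_lie' := fun {_ _} => rfl }
    have hf : Function.Surjective f := by
      rintro ⟨y, hy⟩
      rw [← LieSubmodule.mem_toSubmodule,
        LieIdeal.coe_map_of_surjective (SemiDirectSum.projr_surjective ψ)] at hy
      obtain ⟨z, hz, rfl⟩ := hy
      exact ⟨⟨z, hz⟩, rfl⟩
    have : IsSolvable I := hf.lieAlgebra_isSolvable
    have hI : I = ⊥ := HasTrivialRadical.eq_bot_of_isSolvable I
    have hx' : SemiDirectSum.projr ψ x ∈ I := LieIdeal.mem_map hx
    rw [hI, LieSubmodule.mem_bot] at hx'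
    exact (LieHom.mem_ker).2 hx'
  · rw [← LieIdeal.solvable_iff_le_radical]
    let f : N →ₗ⁅K⁆ (SemiDirectSum.projr ψ).ker :=
      { toFun := fun y => ⟨SemiDirectSum.inl ψ y, (LieHom.mem_ker).2 (SemiDirectSum.projr_inl_apply ψ)⟩
        map_add' := fun _ _ => Subtype.ext (map_add _ _ _)
        map_smul' := fun _ _ => Subtype.ext (map_smul _ _ _)
        map_lie' := fun {_ _} => Subtype.ext (LieHom.map_lie _ _ _) }
    have hf : Function.Surjective f := by
      rintro ⟨⟨y, z⟩, hy⟩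
      have : z = 0 := (LieHom.mem_ker).1 hy
      subst this
      exact ⟨y, rfl⟩
    exact hf.lieAlgebra_isSolvable

end LeviExtension

theorem admitsNontrivialLeviExtension_of_action {K : Type u} [Field K] [CharZero K] {N s : Type u}
    [LieRing N] [LieAlgebra K N] [LieRing s] [LieAlgebra K s] [FiniteDimensional K N]
    [FiniteDimensional K s] [LieAlgebra.IsSolvable N] [LieAlgebra.HasTrivialRadical K s]
    (ψ : s →ₗ⁅K⁆ LieDerivation K N N) (hψ : ∃ x y, ψ x y ≠ 0) :
    AdmitsNontrivialLeviExtension K N := by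
  have hrad := LieAlgebra.radical_semiDirectSum ψ
  refine ⟨LieAlgebra.SemiDirectSum N s ψ, inferInstance, inferInstance, inferInstance, ?_,
    (LieAlgebra.SemiDirectSum.inr ψ).range, ?_, ?_, ?_⟩
  · rw [hrad]
    let E : LieAlgebra.Extension K N s :=
      ⟨_, inferInstance, inferInstance, LieAlgebra.SemiDirectSum.inl ψ,
        LieAlgebra.SemiDirectSum.projr ψ, inferInstance⟩
    exact ⟨E.toKer.symm⟩
  · refine LieAlgebra.HasTrivialRadical.of_equiv
      (LieEquiv.ofInjective (LieAlgebra.SemiDirectSum.inr ψ) fun x y h => ?_)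
    exact congrArg LieAlgebra.SemiDirectSum.right h
  · rw [hrad]
    constructor
    · rw [Submodule.disjoint_def]
      rintro _ ⟨x, rfl⟩ hx
      have : x = 0 := (LieHom.mem_ker).1 hx
      subst this
      rfl
    · rw [codisjoint_iff, eq_top_iff]
      rintro ⟨x, y⟩ -
      refine Submodule.mem_sup.2 ⟨⟨0, y⟩, ⟨y, rfl⟩, ⟨x, 0⟩, rfl, ?_⟩
      simp
  · obtain ⟨x, y, hxy⟩ := hψ
    refine ⟨⟨0, x⟩, ⟨x, rfl⟩, ⟨y, 0⟩, ?_, fun h => hxy ?_⟩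
    · rw [hrad]; rfl
    · have := congrArg LieAlgebra.SemiDirectSum.left h
      simpa using this

theorem FreeNilpotentTwo.admitsNontrivialLeviExtension {K : Type u} [Field K] [CharZero K] {t : ℕ}
    (ht1 : 1 ≤ t) (ht4 : t ≤ 4) : AdmitsNontrivialLeviExtension K (FreeNilpotentTwo K t) := by
  have := FreeNilpotentTwo.finiteDimensional (K := K) ht4
  have : LieRing.IsNilpotent (FreeNilpotentTwo K t) :=
    (LieModule.isNilpotent_iff K _ _).2 ⟨t, FreeNilpotentTwo.lcSeries_eq_bot⟩
  have := hasTrivialRadical_sl_two (K := K)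
  -- The matrix unit at `(0, 1)` sends `v₁` to `v₀ ≠ 0`.
  refine admitsNontrivialLeviExtension_of_action (slDerivation t)
    ⟨LieAlgebra.SpecialLinear.single 0 1 (by decide) 1, vv K t 1, ?_⟩
  rw [slDerivation_vv, LieAlgebra.SpecialLinear.val_single]
  intro h
  have := FreeNilpotentTwo.eq_zero_of_smul_vv_mem (K := K) (t := t) ht1 (h ▸ zero_mem _)
  simp at this

/-! ### From a Levi extension to the action of a perfect Lie algebra -/

section Perfect

variable {K : Type u} [Field K] [CharZero K]

/-- Brackets in the Killing complement of `[S, S]` lie in both complementary ideals, so this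
complement is an abelian ideal, hence zero. -/
theorem LieAlgebra.HasTrivialRadical.lcSeries_one_eq_top (S : Type v) [LieRing S] [LieAlgebra K S]
    [FiniteDimensional K S] [LieAlgebra.HasTrivialRadical K S] : lcSeries K S 1 = ⊤ := by
  have h := LieIdeal.isCompl_killingCompl (lcSeries K S 1)
  have hab : IsLieAbelian (LieIdeal.killingCompl K S (lcSeries K S 1)) := by
    refine ⟨fun x y => Subtype.ext ?_⟩
    have h1 : ⁅(x : S), (y : S)⁆ ∈ lcSeries K S 1 :=
      lie_mem_lcSeries_succ (k := 0) _ (mem_lcSeries_zero _)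
    have h2 : ⁅(x : S), (y : S)⁆ ∈ LieIdeal.killingCompl K S (lcSeries K S 1) :=
      lie_mem_right K S _ _ _ y.2
    have := h.disjoint.le_bot (show ⁅(x : S), (y : S)⁆ ∈ _ ⊓ _ from ⟨h1, h2⟩)
    exact (LieSubmodule.mem_bot _).1 this
  have hbot := LieAlgebra.HasTrivialRadical.eq_bot_of_isSolvable (R := K)
    (LieIdeal.killingCompl K S (lcSeries K S 1))
  have := h.sup_eq_top
  rwa [hbot, sup_bot_eq] at this

/-- The action of a Lie subalgebra on an ideal. -/
def LieIdeal.subalgebraAction {K : Type u} [Field K] {g : Type v} [LieRing g] [LieAlgebra K g]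
    (I : LieIdeal K g) (s : LieSubalgebra K g) : s →ₗ⁅K⁆ LieDerivation K I I where
  toFun x :=
    { toFun := fun n => ⁅(x : g), n⁆
      map_add' := fun a b => lie_add _ _ _
      map_smul' := fun c a => lie_smul _ _ _
      leibniz' := fun a b => by
        apply Subtype.ext
        change ⁅(x : g), ⁅(a : g), (b : g)⁆⁆ = ⁅(a : g), ⁅(x : g), (b : g)⁆⁆ -
          ⁅(b : g), ⁅(x : g), (a : g)⁆⁆
        rw [leibniz_lie, ← lie_skew (b : g)]
        abel }
  map_add' a b := by ext n; exact congrArg Subtype.val (add_lie (a : g) (b : g) n)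
  map_smul' c a := by ext n; exact congrArg Subtype.val (smul_lie c (a : g) n)
  map_lie' {a b} := by ext n; exact congrArg Subtype.val (lie_lie (a : g) (b : g) n)

/-- The nonexistence proof needs only this much of an extension. The action is on the radical `R`,
an isomorphic copy of `N`. -/
theorem AdmitsNontrivialLeviExtension.exists_action {N : Type u} [LieRing N] [LieAlgebra K N]
    (h : AdmitsNontrivialLeviExtension K N) :
    ∃ (R S : Type u) (_ : LieRing R) (_ : LieAlgebra K R) (_ : LieRing S) (_ : LieAlgebra K S)
      (_ : N ≃ₗ⁅K⁆ R) (ρ : S →ₗ⁅K⁆ LieDerivation K R R),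
      lcSeries K S 1 = ⊤ ∧ ∃ x y, ρ x y ≠ 0 := by
  obtain ⟨g, _, _, hfd, ⟨e⟩, s, hs, -, x, hx, y, hy, hxy⟩ := h
  exact ⟨LieAlgebra.radical K g, s, inferInstance, inferInstance, inferInstance, inferInstance,
    e.symm, LieIdeal.subalgebraAction _ s,
    LieAlgebra.HasTrivialRadical.lcSeries_one_eq_top (K := K) s, ⟨x, hx⟩, ⟨y, hy⟩,
    fun h0 => hxy (congrArg Subtype.val h0)⟩

end Perfect

/-! ### Perfect spaces of `2 × 2` matrices -/

section MatrixPerfect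

variable {K : Type u} [Field K]

theorem Submodule.exists_le_span_pair_of_finrank_le_two {V : Type v} [AddCommGroup V] [Module K V]
    {P : Submodule K V} [FiniteDimensional K P] (h : Module.finrank K P ≤ 2) :
    ∃ A B : V, P ≤ Submodule.span K {A, B} := by
  obtain h | h : Module.finrank K P ≤ 1 ∨ Module.finrank K P = 2 := by omega
  · obtain ⟨v, hv⟩ := finrank_le_one_iff.1 h
    refine ⟨v, 0, fun w hw => ?_⟩
    obtain ⟨c, hc⟩ := hv ⟨w, hw⟩
    exact Submodule.mem_span_pair.2 ⟨c, 0, by simpa using congrArg Subtype.val hc⟩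
  · let b := Module.finBasisOfFinrankEq K P h
    refine ⟨b 0, b 1, fun w hw => Submodule.mem_span_pair.2
      ⟨b.repr ⟨w, hw⟩ 0, b.repr ⟨w, hw⟩ 1, ?_⟩⟩
    have := congrArg Subtype.val (b.sum_repr ⟨w, hw⟩)
    rw [Fin.sum_univ_two] at this
    exact this

/-- A perfect space of `2 × 2` matrices is zero or contains all matrices of trace zero. -/
theorem eq_bot_or_mem_of_le_span_commutators {P : Submodule K (Matrix (Fin 2) (Fin 2) K)}
    (hP : P ≤ Submodule.span K {C | ∃ A ∈ P, ∃ B ∈ P, C = A * B - B * A}) :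
    P = ⊥ ∨ ∀ M : Matrix (Fin 2) (Fin 2) K, M.trace = 0 → M ∈ P := by
  by_cases h : Module.finrank K P ≤ 2
  · left
    -- All commutators within a plane are multiples of a single one, so a perfect `P` in a plane
    -- lies on a line; a second application, with `B = 0`, gives zero.
    have step : ∀ A B : Matrix (Fin 2) (Fin 2) K, P ≤ Submodule.span K {A, B} →
        P ≤ Submodule.span K {A * B - B * A} := by
      intro A B hAB
      refine hP.trans (Submodule.span_le.2 ?_)
      rintro _ ⟨X, hX, Y, hY, rfl⟩
      obtain ⟨a, b, rfl⟩ := Submodule.mem_span_pair.1 (hAB hX)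
      obtain ⟨c, d, rfl⟩ := Submodule.mem_span_pair.1 (hAB hY)
      refine Submodule.mem_span_singleton.2 ⟨a * d - b * c, ?_⟩
      simp only [add_mul, mul_add, smul_mul_assoc, mul_smul_comm]
      module
    obtain ⟨A, B, hAB⟩ := Submodule.exists_le_span_pair_of_finrank_le_two h
    have h1 := step _ _ hAB
    have h2 := step (A * B - B * A) 0 (h1.trans (Submodule.span_mono (by simp)))
    simpa using h2
  · right
    -- Commutators have trace zero and `T` has dimension 3, so dimension at least 3 forces `P = T`.
    let T : Submodule K (Matrix (Fin 2) (Fin 2) K) := LinearMap.ker (Matrix.traceLinearMap (Fin 2) K K)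
    have hPT : P ≤ T := by
      refine hP.trans (Submodule.span_le.2 ?_)
      rintro _ ⟨X, hX, Y, hY, rfl⟩
      change Matrix.trace (X * Y - Y * X) = 0
      rw [Matrix.trace_sub, Matrix.trace_mul_comm, sub_self]
    have hT : Module.finrank K T ≤ 3 := by
      have hr := LinearMap.finrank_range_add_finrank_ker (Matrix.traceLinearMap (Fin 2) K K)
      have hs : LinearMap.range (Matrix.traceLinearMap (Fin 2) K K) = ⊤ := by
        rw [LinearMap.range_eq_top]
        exact fun c => ⟨Matrix.single (0 : Fin 2) (0 : Fin 2) c, by simp⟩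
      rw [hs, finrank_top, Module.finrank_self, Module.finrank_matrix] at hr
      change 1 + Module.finrank K T = _ at hr
      simp at hr
      omega
    have := Submodule.eq_of_le_of_finrank_le hPT (by omega)
    intro M hM
    rw [this]
    exact hM

end MatrixPerfect

/-! ### Actions that are trivial modulo the derived algebra -/

section TwistedDerivation

variable {K : Type u} [Field K] {L N : Type*} [LieRing L] [LieAlgebra K L] [LieRing N]
  [LieAlgebra K N]

/-- A derivation relative to a homomorphism with values in the derived algebra raises the degree
with respect to the lower central series. -/
theorem mem_lcSeries_succ_of_leibniz (q : L →ₗ⁅K⁆ N) (δ : L →ₗ[K] N)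
    (hδ : ∀ x y, δ ⁅x, y⁆ = ⁅δ x, q y⁆ + ⁅q x, δ y⁆) (h1 : ∀ x, δ x ∈ lcSeries K N 1)
    {k : ℕ} {x : L} (hx : x ∈ lcSeries K L k) : δ x ∈ lcSeries K N (k + 1) := by
  induction k generalizing x with
  | zero => exact h1 x
  | succ k ih =>
    refine lcSeries_succ_induction (p := fun x => δ x ∈ lcSeries K N (k + 1 + 1)) (by simp)
      (fun x y hx hy => ?_) (fun c x hx => ?_) (fun x y hy => ?_) hx
    · rw [map_add]; exact add_mem hx hy
    · rw [map_smul]; exact Submodule.smul_mem _ c hx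
    · rw [hδ]
      have h := lie_mem_lcSeries_add (h1 x) (map_mem_lcSeries q hy)
      rw [show 1 + k + 1 = k + 1 + 1 by ring] at h
      exact add_mem h (lie_mem_lcSeries_succ _ (ih hy))

/-- A perfect Lie algebra acting by derivations on a nilpotent Lie algebra acts trivially if it acts
trivially modulo the derived algebra. -/
theorem action_eq_zero_of_mem_lcSeries_one {S : Type*} [LieRing S] [LieAlgebra K S]
    (hS : lcSeries K S 1 = ⊤) {t : ℕ} (ht : lcSeries K N t = ⊥) (ρ : S →ₗ⁅K⁆ LieDerivation K N N)
    (h : ∀ x y, ρ x y ∈ lcSeries K N 1) (x : S) (y : N) : ρ x y = 0 := by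
  have key : ∀ k x y, ρ x y ∈ lcSeries K N (k + 1) := by
    intro k
    induction k with
    | zero => exact h
    | succ k ih =>
      intro x
      have hx : x ∈ lcSeries K S (0 + 1) := by rw [zero_add, hS]; trivial
      refine lcSeries_succ_induction (p := fun x => ∀ y, ρ x y ∈ lcSeries K N (k + 1 + 1))
        (by simp) (fun a b ha hb y => ?_) (fun c a ha y => ?_) (fun a b _ y => ?_) hx
      · rw [map_add]; exact add_mem (ha y) (hb y)
      · rw [map_smul]; exact Submodule.smul_mem _ c (ha y)
      -- Each `ρ c` raises the degree by one, so on a bracket `⁅a, b⁆` the two compositions gain one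
      -- more degree than `ρ a` and `ρ b` separately.
      · have hstep : ∀ c z, z ∈ lcSeries K N (k + 1) → ρ c z ∈ lcSeries K N (k + 1 + 1) :=
          fun c z hz => mem_lcSeries_succ_of_leibniz LieHom.id (ρ c : N →ₗ[K] N)
            (fun x y => by
              change ρ c ⁅x, y⁆ = ⁅ρ c x, y⁆ + ⁅x, ρ c y⁆
              rw [LieDerivation.apply_lie_eq_add, add_comm]) (h c) hz
        rw [LieHom.map_lie, LieDerivation.lie_apply]
        exact sub_mem (hstep _ _ (ih b y)) (hstep _ _ (ih a y))
  have := lcSeries_anti (Nat.le_succ t) (key t x y)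
  rwa [ht, LieSubmodule.mem_bot] at this

end TwistedDerivation

/-! ### The matrix induced by a derivation on `N/N^2` -/

section GradedAction

variable {K : Type u} [Field K] {N : Type v} [LieRing N] [LieAlgebra K N]

/-- The derivation `D` of `N` acts on the generators of `N` modulo the derived algebra through the
matrix `M`. -/
def InducesMatrix (q : FreeLieTwo K →ₗ⁅K⁆ N) (D : LieDerivation K N N)
    (M : Matrix (Fin 2) (Fin 2) K) : Prop :=
  ∀ y, D (q y) - q (matrixDerivation M y) ∈ lcSeries K N 1

/-- The difference between a derivation of `N` and a derivation of the free Lie algebra. -/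
noncomputable def derivationDefect (q : FreeLieTwo K →ₗ⁅K⁆ N) (D : LieDerivation K N N)
    (M : Matrix (Fin 2) (Fin 2) K) : FreeLieTwo K →ₗ[K] N :=
  (D : N →ₗ[K] N) ∘ₗ (q : FreeLieTwo K →ₗ[K] N) -
    (q : FreeLieTwo K →ₗ[K] N) ∘ₗ (matrixDerivation M : FreeLieTwo K →ₗ[K] FreeLieTwo K)

theorem derivationDefect_apply (q : FreeLieTwo K →ₗ⁅K⁆ N) (D : LieDerivation K N N)
    (M : Matrix (Fin 2) (Fin 2) K) (y : FreeLieTwo K) :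
    derivationDefect q D M y = D (q y) - q (matrixDerivation M y) := rfl

theorem derivationDefect_lie (q : FreeLieTwo K →ₗ⁅K⁆ N) (D : LieDerivation K N N)
    (M : Matrix (Fin 2) (Fin 2) K) (x y : FreeLieTwo K) : derivationDefect q D M ⁅x, y⁆ =
      ⁅derivationDefect q D M x, q y⁆ + ⁅q x, derivationDefect q D M y⁆ := by
  simp only [derivationDefect_apply, LieHom.map_lie, LieDerivation.apply_lie_eq_add, map_add,
    sub_lie, lie_sub]
  abel

variable {q : FreeLieTwo K →ₗ⁅K⁆ N}

theorem InducesMatrix.defect_mem {D : LieDerivation K N N} {M : Matrix (Fin 2) (Fin 2) K}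
    (h : InducesMatrix q D M) {k : ℕ} {y : FreeLieTwo K} (hy : y ∈ lcSeries K (FreeLieTwo K) k) :
    D (q y) - q (matrixDerivation M y) ∈ lcSeries K N (k + 1) :=
  mem_lcSeries_succ_of_leibniz q (derivationDefect q D M) (derivationDefect_lie q D M) h hy

theorem inducesMatrix_of_freeGen {D : LieDerivation K N N} {M : Matrix (Fin 2) (Fin 2) K}
    (h : ∀ j, D (q (freeGen K j)) - q (matrixDerivation M (freeGen K j)) ∈ lcSeries K N 1) :
    InducesMatrix q D M := by
  intro y
  obtain ⟨α, β, u, hu, rfl⟩ := exists_sub_mem_lcSeries_one span_freeGen_sup_lcSeries_one y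
  rw [← derivationDefect_apply, map_add, map_add, map_smul, map_smul]
  refine add_mem (add_mem (Submodule.smul_mem _ _ (h 0)) (Submodule.smul_mem _ _ (h 1))) ?_
  exact sub_mem (D.apply_mem_lcSeries (map_mem_lcSeries q hu))
    (map_mem_lcSeries q ((matrixDerivation M).apply_mem_lcSeries hu))

theorem exists_inducesMatrix (hq : Function.Surjective q) (D : LieDerivation K N N) :
    ∃ M, InducesMatrix q D M := by
  have h : ∀ j, ∃ α β : K, ∃ u ∈ lcSeries K N 1, D (q (freeGen K j)) =
      α • q (freeGen K 0) + β • q (freeGen K 1) + u := fun j =>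
    exists_sub_mem_lcSeries_one (span_map_sup_lcSeries_one hq span_freeGen_sup_lcSeries_one) _
  choose α β u hu h using h
  refine ⟨Matrix.of ![α, β], inducesMatrix_of_freeGen fun j => ?_⟩
  rw [h, matrixDerivation_freeGen, map_add, map_smul, map_smul]
  simpa using hu j

/-- As the kernel lies in the derived algebra, the images of the generators stay independent modulo
`N^2`. -/
theorem InducesMatrix.unique (hq : Function.Surjective q)
    (hker : q.ker ≤ lcSeries K (FreeLieTwo K) 1)
    {D : LieDerivation K N N} {M M' : Matrix (Fin 2) (Fin 2) K} (h : InducesMatrix q D M)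
    (h' : InducesMatrix q D M') : M = M' := by
  have key : ∀ j, M 0 j - M' 0 j = 0 ∧ M 1 j - M' 1 j = 0 := by
    intro j
    refine eq_zero_of_mem_lcSeries_one ?_
    have h0 := sub_mem (h' (freeGen K j)) (h (freeGen K j))
    rw [sub_sub_sub_cancel_left, ← map_sub] at h0
    obtain ⟨x, hx, hxq⟩ := (mem_lcSeries_iff_of_surjective hq 1 _).1 h0
    rw [eq_comm, ← sub_eq_zero, ← map_sub, ← LieHom.mem_ker] at hxq
    have := add_mem (hker hxq) hx
    rw [sub_add_cancel, matrixDerivation_freeGen, matrixDerivation_freeGen] at this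
    convert this using 1
    module
  ext i j
  fin_cases i
  · exact sub_eq_zero.1 (key j).1
  · exact sub_eq_zero.1 (key j).2

theorem InducesMatrix.zero : InducesMatrix q 0 0 :=
  inducesMatrix_of_freeGen fun j => by simp [matrixDerivation_freeGen]

theorem InducesMatrix.add {D D' : LieDerivation K N N} {M M' : Matrix (Fin 2) (Fin 2) K}
    (h : InducesMatrix q D M) (h' : InducesMatrix q D' M') :
    InducesMatrix q (D + D') (M + M') := by
  refine inducesMatrix_of_freeGen fun j => ?_
  convert add_mem (h (freeGen K j)) (h' (freeGen K j)) using 1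
  simp only [matrixDerivation_freeGen, LieDerivation.add_apply, Matrix.add_apply, map_add, map_smul]
  module

theorem InducesMatrix.smul (c : K) {D : LieDerivation K N N} {M : Matrix (Fin 2) (Fin 2) K}
    (h : InducesMatrix q D M) : InducesMatrix q (c • D) (c • M) := by
  refine inducesMatrix_of_freeGen fun j => ?_
  have h0 := Submodule.smul_mem (lcSeries K N 1).toSubmodule c (h (freeGen K j))
  rw [LieSubmodule.mem_toSubmodule] at h0
  convert h0 using 1
  simp only [matrixDerivation_freeGen, LieDerivation.smul_apply, Matrix.smul_apply, map_add,
    map_smul, smul_eq_mul]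
  module

theorem InducesMatrix.lie {D D' : LieDerivation K N N} {M M' : Matrix (Fin 2) (Fin 2) K}
    (h : InducesMatrix q D M) (h' : InducesMatrix q D' M') :
    InducesMatrix q ⁅D, D'⁆ (M * M' - M' * M) := by
  refine inducesMatrix_of_freeGen fun j => ?_
  have e1 := h (matrixDerivation M' (freeGen K j))
  have e2 := h' (matrixDerivation M (freeGen K j))
  have e3 := D.apply_mem_lcSeries (h' (freeGen K j))
  have e4 := D'.apply_mem_lcSeries (h (freeGen K j))
  convert sub_mem (add_mem e1 e3) (add_mem e2 e4) using 1
  simp only [matrixDerivation_freeGen, LieDerivation.lie_apply, map_add, map_smul, map_sub,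
    Matrix.sub_apply, Matrix.mul_apply, Fin.sum_univ_two]
  module

/-- A perfect Lie algebra acting by derivations on a two-generated nilpotent Lie algebra either acts
trivially or induces all endomorphisms of trace zero modulo the derived algebra. -/
theorem action_eq_zero_or_exists_inducesMatrix (hq : Function.Surjective q)
    (hker : q.ker ≤ lcSeries K (FreeLieTwo K) 1) {t : ℕ} (ht : lcSeries K N t = ⊥)
    {S : Type*} [LieRing S] [LieAlgebra K S] (hS : lcSeries K S 1 = ⊤)
    (ρ : S →ₗ⁅K⁆ LieDerivation K N N) :
    (∀ x y, ρ x y = 0) ∨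
      ∀ M : Matrix (Fin 2) (Fin 2) K, M.trace = 0 → ∃ x, InducesMatrix q (ρ x) M := by
  let P : Submodule K (Matrix (Fin 2) (Fin 2) K) :=
    { carrier := {M | ∃ x, InducesMatrix q (ρ x) M}
      zero_mem' := ⟨0, by rw [map_zero]; exact InducesMatrix.zero⟩
      add_mem' := by
        rintro M M' ⟨x, hx⟩ ⟨y, hy⟩
        exact ⟨x + y, by rw [map_add]; exact hx.add hy⟩
      smul_mem' := by
        rintro c M ⟨x, hx⟩
        exact ⟨c • x, by rw [map_smul]; exact hx.smul c⟩ }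
  -- Perfectness of `S` passes to the space of induced matrices: an element of `S` is a combination
  -- of brackets, which induce commutators, and the induced matrix is unique.
  have hP : P ≤ Submodule.span K {C | ∃ A ∈ P, ∃ B ∈ P, C = A * B - B * A} := by
    rintro M ⟨x, hx⟩
    have hxS : x ∈ lcSeries K S (0 + 1) := by rw [zero_add, hS]; trivial
    obtain ⟨M', hM', h⟩ := lcSeries_succ_induction (p := fun x =>
      ∃ M ∈ Submodule.span K {C | ∃ A ∈ P, ∃ B ∈ P, C = A * B - B * A},
        InducesMatrix q (ρ x) M) ⟨0, zero_mem _, by rw [map_zero]; exact InducesMatrix.zero⟩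
      (by
        rintro x y ⟨M, hM, hx⟩ ⟨M', hM', hy⟩
        exact ⟨M + M', add_mem hM hM', by rw [map_add]; exact hx.add hy⟩)
      (by
        rintro c x ⟨M, hM, hx⟩
        exact ⟨c • M, Submodule.smul_mem _ c hM, by rw [map_smul]; exact hx.smul c⟩)
      (fun x y _ => by
        obtain ⟨M, hx⟩ := exists_inducesMatrix hq (ρ x)
        obtain ⟨M', hy⟩ := exists_inducesMatrix hq (ρ y)
        exact ⟨M * M' - M' * M, Submodule.subset_span ⟨M, ⟨x, hx⟩, M', ⟨y, hy⟩, rfl⟩,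
          by rw [LieHom.map_lie]; exact hx.lie hy⟩) hxS
    rwa [hx.unique hq hker h]
  refine (eq_bot_or_mem_of_le_span_commutators hP).imp (fun h => ?_) fun h M hM => h M hM
  refine action_eq_zero_of_mem_lcSeries_one hS ht ρ fun x y => ?_
  obtain ⟨M, hM⟩ := exists_inducesMatrix hq (ρ x)
  have hM0 : M = 0 := by
    have : M ∈ P := ⟨x, hM⟩
    rwa [h] at this
  obtain ⟨y, rfl⟩ := hq y
  have h0 := InducesMatrix.zero (q := q) y
  have := sub_mem (hM y) h0
  subst hM0
  simpa using this

/-- If the matrix `M` is induced by a derivation of `N`, then the corresponding derivation of the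
free Lie algebra preserves the kernel of the projection to `N` in the associated graded algebra. -/
theorem InducesMatrix.matrixDerivation_mem (hq : Function.Surjective q) {D : LieDerivation K N N}
    {M : Matrix (Fin 2) (Fin 2) K} (h : InducesMatrix q D M) {k : ℕ} {y : FreeLieTwo K}
    (hy : y ∈ lcSeries K (FreeLieTwo K) k)
    (hyU : y ∈ q.ker ⊔ lcSeries K (FreeLieTwo K) (k + 1)) :
    matrixDerivation M y ∈ q.ker ⊔ lcSeries K (FreeLieTwo K) (k + 1) := by
  obtain ⟨i, hi, u, hu, rfl⟩ := (LieSubmodule.mem_sup _ _ _).1 hyU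
  have hik : i ∈ lcSeries K (FreeLieTwo K) k := by
    simpa using sub_mem hy (lcSeries_anti (Nat.le_succ k) hu)
  rw [map_add]
  refine add_mem ?_ ((le_sup_right : _ ≤ q.ker ⊔ _) ((matrixDerivation M).apply_mem_lcSeries hu))
  -- As `q i = 0`, the defect at `i` is `-q (matrixDerivation M i)`. This lies one term deeper, so
  -- it can be lifted there and the difference of lifts is in the kernel.
  have h0 := neg_mem (h.defect_mem hik)
  rw [(LieHom.mem_ker).1 hi, map_zero, zero_sub, neg_neg] at h0
  obtain ⟨v, hv, hvq⟩ := (mem_lcSeries_iff_of_surjective hq _ _).1 h0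
  rw [eq_comm, ← sub_eq_zero, ← map_sub, ← LieHom.mem_ker] at hvq
  exact (LieSubmodule.mem_sup _ _ _).2 ⟨_, hvq, v, hv, sub_add_cancel _ _⟩

end GradedAction

/-! ### Irreducibility of the layers in degrees 2, 3 and 4 -/

section Irreducibility

variable {K : Type u} [Field K]

/-- The raising operator on the free Lie algebra on two generators. -/
noncomputable abbrev raising (K : Type u) [Field K] :
    LieDerivation K (FreeLieTwo K) (FreeLieTwo K) := matrixDerivation !![0, 1; 0, 0]

/-- The lowering operator on the free Lie algebra on two generators. -/
noncomputable abbrev lowering (K : Type u) [Field K] :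
    LieDerivation K (FreeLieTwo K) (FreeLieTwo K) := matrixDerivation !![0, 0; 1, 0]

theorem raising_freeGen_zero : raising K (freeGen K 0) = 0 := by
  simp [raising, matrixDerivation_freeGen]

theorem raising_freeGen_one : raising K (freeGen K 1) = freeGen K 0 := by
  simp [raising, matrixDerivation_freeGen]

theorem lowering_freeGen_zero : lowering K (freeGen K 0) = freeGen K 1 := by
  simp [lowering, matrixDerivation_freeGen]

theorem lowering_freeGen_one : lowering K (freeGen K 1) = 0 := by
  simp [lowering, matrixDerivation_freeGen]

theorem raising_w : raising K ⁅freeGen K 0, freeGen K 1⁆ = 0 := by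
  rw [LieDerivation.apply_lie_eq_add, raising_freeGen_zero, raising_freeGen_one, lie_self, zero_lie,
    add_zero]

theorem lowering_w : lowering K ⁅freeGen K 0, freeGen K 1⁆ = 0 := by
  rw [LieDerivation.apply_lie_eq_add, lowering_freeGen_zero, lowering_freeGen_one, lie_self,
    lie_zero, add_zero]

theorem freeGen_w_mem : ⁅freeGen K 0, freeGen K 1⁆ ∈ lcSeries K (FreeLieTwo K) 1 :=
  lie_mem_lcSeries_succ (k := 0) _ (mem_lcSeries_zero _)

theorem freeGen_z_mem (i : Fin 2) :
    ⁅freeGen K i, ⁅freeGen K 0, freeGen K 1⁆⁆ ∈ lcSeries K (FreeLieTwo K) 2 :=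
  lie_mem_lcSeries_succ _ freeGen_w_mem

theorem freeGen_x_mem (i j : Fin 2) :
    ⁅freeGen K i, ⁅freeGen K j, ⁅freeGen K 0, freeGen K 1⁆⁆⁆ ∈ lcSeries K (FreeLieTwo K) 3 :=
  lie_mem_lcSeries_succ _ (freeGen_z_mem j)

theorem mem_of_smul_mem {L : Type v} [LieRing L] [LieAlgebra K L] {U : LieIdeal K L} {c : K}
    (hc : c ≠ 0) {x : L} (h : c • x ∈ U) : x ∈ U :=
  (Submodule.smul_mem_iff U.toSubmodule hc).1 h

variable {U : LieIdeal K (FreeLieTwo K)}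

theorem lcSeries_one_le_of_not_le {I : LieIdeal K (FreeLieTwo K)}
    (h2 : lcSeries K (FreeLieTwo K) 2 ≤ U) (hI : I ≤ U)
    {p : FreeLieTwo K} (hp : p ∈ I) (hp1 : p ∈ lcSeries K (FreeLieTwo K) 1)
    (hp2 : p ∉ lcSeries K (FreeLieTwo K) 2) : lcSeries K (FreeLieTwo K) 1 ≤ U := by
  obtain ⟨γ, u, hu, rfl⟩ := exists_sub_mem_lcSeries_two span_freeGen_sup_lcSeries_one hp1
  have hγ : γ ≠ 0 := by
    rintro rfl
    exact hp2 (by simpa using hu)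
  have hw : ⁅freeGen K 0, freeGen K 1⁆ ∈ U :=
    mem_of_smul_mem hγ (by simpa using sub_mem (hI hp) (h2 hu))
  intro x hx
  obtain ⟨γ, u, hu, rfl⟩ := exists_sub_mem_lcSeries_two span_freeGen_sup_lcSeries_one hx
  exact add_mem (Submodule.smul_mem _ _ hw) (h2 hu)

/-- Raising sends `z₁ ↦ z₀ ↦ 0` and lowering sends `z₀ ↦ z₁`, so any nonzero combination yields `z₀`
and then both. Stability of `U` is assumed only on this layer, which is all that
`InducesMatrix.matrixDerivation_mem` provides. -/
theorem lcSeries_two_le_of_not_le {I : LieIdeal K (FreeLieTwo K)}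
    (h3 : lcSeries K (FreeLieTwo K) 3 ≤ U) (hI : I ≤ U)
    (hr : ∀ y ∈ lcSeries K (FreeLieTwo K) 2, y ∈ U → raising K y ∈ U)
    (hl : ∀ y ∈ lcSeries K (FreeLieTwo K) 2, y ∈ U → lowering K y ∈ U)
    {p : FreeLieTwo K} (hp : p ∈ I) (hp2 : p ∈ lcSeries K (FreeLieTwo K) 2)
    (hp3 : p ∉ lcSeries K (FreeLieTwo K) 3) : lcSeries K (FreeLieTwo K) 2 ≤ U := by
  have rz0 : raising K ⁅freeGen K 0, ⁅freeGen K 0, freeGen K 1⁆⁆ = 0 := by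
    rw [LieDerivation.apply_lie_eq_add, raising_w, raising_freeGen_zero, lie_zero, zero_lie,
      add_zero]
  have rz1 : raising K ⁅freeGen K 1, ⁅freeGen K 0, freeGen K 1⁆⁆ =
      ⁅freeGen K 0, ⁅freeGen K 0, freeGen K 1⁆⁆ := by
    rw [LieDerivation.apply_lie_eq_add, raising_w, raising_freeGen_one, lie_zero, zero_add]
  have lz0 : lowering K ⁅freeGen K 0, ⁅freeGen K 0, freeGen K 1⁆⁆ =
      ⁅freeGen K 1, ⁅freeGen K 0, freeGen K 1⁆⁆ := by
    rw [LieDerivation.apply_lie_eq_add, lowering_w, lowering_freeGen_zero, lie_zero, zero_add]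
  obtain ⟨α, β, u, hu, rfl⟩ := exists_sub_mem_lcSeries_three span_freeGen_sup_lcSeries_one hp2
  have hU : α • ⁅freeGen K 0, ⁅freeGen K 0, freeGen K 1⁆⁆ +
      β • ⁅freeGen K 1, ⁅freeGen K 0, freeGen K 1⁆⁆ ∈ U := by
    simpa using sub_mem (hI hp) (h3 hu)
  have hz0 : ⁅freeGen K 0, ⁅freeGen K 0, freeGen K 1⁆⁆ ∈ U := by
    by_cases hβ : β = 0
    · have hα : α ≠ 0 := by
        rintro rfl
        exact hp3 (by simpa [hβ] using hu)
      exact mem_of_smul_mem hα (by simpa [hβ] using hU)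
    · refine mem_of_smul_mem hβ ?_
      have := hr _ (add_mem (Submodule.smul_mem _ _ (freeGen_z_mem 0))
        (Submodule.smul_mem _ _ (freeGen_z_mem 1))) hU
      rwa [map_add, map_smul, map_smul, rz0, rz1, smul_zero, zero_add] at this
  have hz1 : ⁅freeGen K 1, ⁅freeGen K 0, freeGen K 1⁆⁆ ∈ U := lz0 ▸ hl _ (freeGen_z_mem 0) hz0
  intro x hx
  obtain ⟨α, β, u, hu, rfl⟩ := exists_sub_mem_lcSeries_three span_freeGen_sup_lcSeries_one hx
  exact add_mem (add_mem (Submodule.smul_mem _ _ hz0) (Submodule.smul_mem _ _ hz1)) (h3 hu)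

/-- Raising a nonzero combination at most twice isolates `[v₀, z₀]`, and lowering then recovers the
other two brackets. Both directions meet a factor 2, which must be invertible. -/
theorem lcSeries_three_le_of_not_le [CharZero K] {I : LieIdeal K (FreeLieTwo K)}
    (h4 : lcSeries K (FreeLieTwo K) 4 ≤ U) (hI : I ≤ U)
    (hr : ∀ y ∈ lcSeries K (FreeLieTwo K) 3, y ∈ U → raising K y ∈ U)
    (hl : ∀ y ∈ lcSeries K (FreeLieTwo K) 3, y ∈ U → lowering K y ∈ U)
    {p : FreeLieTwo K} (hp : p ∈ I) (hp3 : p ∈ lcSeries K (FreeLieTwo K) 3)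
    (hp4 : p ∉ lcSeries K (FreeLieTwo K) 4) : lcSeries K (FreeLieTwo K) 3 ≤ U := by
  obtain ⟨α, β, γ, u, hu, rfl⟩ := exists_sub_mem_lcSeries_four span_freeGen_sup_lcSeries_one hp3
  have hm0 := freeGen_x_mem (K := K) 0 0
  have hm1 := freeGen_x_mem (K := K) 0 1
  have hm2 := freeGen_x_mem (K := K) 1 1
  have rx0 : raising K ⁅freeGen K 0, ⁅freeGen K 0, ⁅freeGen K 0, freeGen K 1⁆⁆⁆ = 0 := by
    simp only [LieDerivation.apply_lie_eq_add (raising K), raising_freeGen_zero,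
      raising_freeGen_one, lie_self, lie_zero, zero_lie, add_zero]
  have rx1 : raising K ⁅freeGen K 0, ⁅freeGen K 1, ⁅freeGen K 0, freeGen K 1⁆⁆⁆ =
      ⁅freeGen K 0, ⁅freeGen K 0, ⁅freeGen K 0, freeGen K 1⁆⁆⁆ := by
    simp only [LieDerivation.apply_lie_eq_add (raising K), raising_freeGen_zero,
      raising_freeGen_one, lie_self, lie_zero, zero_lie, add_zero, zero_add]
  have rx2 : raising K ⁅freeGen K 1, ⁅freeGen K 1, ⁅freeGen K 0, freeGen K 1⁆⁆⁆ =
      (2 : K) • ⁅freeGen K 0, ⁅freeGen K 1, ⁅freeGen K 0, freeGen K 1⁆⁆⁆ := by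
    simp only [LieDerivation.apply_lie_eq_add (raising K), raising_freeGen_zero,
      raising_freeGen_one, lie_self, lie_zero, zero_lie, add_zero, zero_add, lie_lie_lie_comm,
      two_smul]
  have lx0 : lowering K ⁅freeGen K 0, ⁅freeGen K 0, ⁅freeGen K 0, freeGen K 1⁆⁆⁆ =
      (2 : K) • ⁅freeGen K 0, ⁅freeGen K 1, ⁅freeGen K 0, freeGen K 1⁆⁆⁆ := by
    simp only [LieDerivation.apply_lie_eq_add (lowering K), lowering_freeGen_zero,
      lowering_freeGen_one, lie_self, lie_zero, add_zero, zero_add, lie_lie_lie_comm,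
      two_smul]
  have lx1 : lowering K ⁅freeGen K 0, ⁅freeGen K 1, ⁅freeGen K 0, freeGen K 1⁆⁆⁆ =
      ⁅freeGen K 1, ⁅freeGen K 1, ⁅freeGen K 0, freeGen K 1⁆⁆⁆ := by
    simp only [LieDerivation.apply_lie_eq_add (lowering K), lowering_freeGen_zero,
      lowering_freeGen_one, lie_self, lie_zero, zero_lie, add_zero, zero_add]
  have hU : α • ⁅freeGen K 0, ⁅freeGen K 0, ⁅freeGen K 0, freeGen K 1⁆⁆⁆ +
      β • ⁅freeGen K 0, ⁅freeGen K 1, ⁅freeGen K 0, freeGen K 1⁆⁆⁆ +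
      γ • ⁅freeGen K 1, ⁅freeGen K 1, ⁅freeGen K 0, freeGen K 1⁆⁆⁆ ∈ U := by
    simpa using sub_mem (hI hp) (h4 hu)
  have hU1 := hr _ (add_mem (add_mem (Submodule.smul_mem _ _ hm0) (Submodule.smul_mem _ _ hm1))
    (Submodule.smul_mem _ _ hm2)) hU
  rw [map_add, map_add, map_smul, map_smul, map_smul, rx0, rx1, rx2, smul_zero, zero_add,
    smul_smul] at hU1
  have hU2 := hr _ (add_mem (Submodule.smul_mem _ _ hm0) (Submodule.smul_mem _ _ hm1)) hU1
  rw [map_add, map_smul, map_smul, rx0, rx1, smul_zero, zero_add] at hU2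
  have hx0 : ⁅freeGen K 0, ⁅freeGen K 0, ⁅freeGen K 0, freeGen K 1⁆⁆⁆ ∈ U := by
    by_cases hγ : γ = 0
    · subst hγ
      by_cases hβ : β = 0
      · subst hβ
        refine mem_of_smul_mem (c := α) ?_ (by simpa using hU)
        rintro rfl
        exact hp4 (by simpa using hu)
      · exact mem_of_smul_mem hβ (by simpa using hU1)
    · exact mem_of_smul_mem (mul_ne_zero hγ two_ne_zero) hU2
  have hx1 : ⁅freeGen K 0, ⁅freeGen K 1, ⁅freeGen K 0, freeGen K 1⁆⁆⁆ ∈ U :=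
    mem_of_smul_mem (two_ne_zero (α := K)) (lx0 ▸ hl _ hm0 hx0)
  have hx2 : ⁅freeGen K 1, ⁅freeGen K 1, ⁅freeGen K 0, freeGen K 1⁆⁆⁆ ∈ U := lx1 ▸ hl _ hm1 hx1
  intro x hx
  obtain ⟨α, β, γ, u, hu, rfl⟩ := exists_sub_mem_lcSeries_four span_freeGen_sup_lcSeries_one hx
  exact add_mem (add_mem (add_mem (Submodule.smul_mem _ _ hx0) (Submodule.smul_mem _ _ hx1))
    (Submodule.smul_mem _ _ hx2)) (h4 hu)

end Irreducibility

/-! ### Nonexistence of nontrivial Levi extensions for proper quotients -/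

section NoLeviExtension

variable {K : Type u} [Field K] [CharZero K] {N : Type v} [LieRing N] [LieAlgebra K N]

/-- If a perfect Lie algebra acts nontrivially by derivations on a quotient of the free nilpotent
Lie algebra on two generators of the same nilindex `t ≤ 4`, then the quotient is the free nilpotent
Lie algebra itself. -/
theorem ker_le_lcSeries_of_action {q : FreeLieTwo K →ₗ⁅K⁆ N} (hq : Function.Surjective q)
    (hker : q.ker ≤ lcSeries K (FreeLieTwo K) 1) {t : ℕ} (ht4 : t ≤ 4)
    (ht : lcSeries K (FreeLieTwo K) t ≤ q.ker)
    (ht' : ¬ lcSeries K (FreeLieTwo K) (t - 1) ≤ q.ker)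
    {S : Type*} [LieRing S] [LieAlgebra K S] (hS : lcSeries K S 1 = ⊤)
    (ρ : S →ₗ⁅K⁆ LieDerivation K N N) (hρ : ∃ x y, ρ x y ≠ 0) :
    q.ker ≤ lcSeries K (FreeLieTwo K) t := by
  have hN : lcSeries K N t = ⊥ := by
    rw [LieSubmodule.eq_bot_iff]
    intro y hy
    obtain ⟨x, hx, rfl⟩ := (mem_lcSeries_iff_of_surjective hq t y).1 hy
    exact (LieHom.mem_ker).1 (ht hx)
  have hM : ∀ M : Matrix (Fin 2) (Fin 2) K, M.trace = 0 → ∃ x, InducesMatrix q (ρ x) M := by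
    refine (action_eq_zero_or_exists_inducesMatrix hq hker hN hS ρ).resolve_left fun h => ?_
    obtain ⟨x, y, hxy⟩ := hρ
    exact hxy (h x y)
  obtain ⟨x, hx⟩ := hM !![0, 1; 0, 0] (by simp [Matrix.trace_fin_two])
  obtain ⟨y, hy⟩ := hM !![0, 0; 1, 0] (by simp [Matrix.trace_fin_two])
  have step : ∀ k, k + 1 ≤ t → q.ker ≤ lcSeries K (FreeLieTwo K) k →
      (∀ U : LieIdeal K (FreeLieTwo K), lcSeries K (FreeLieTwo K) (k + 1) ≤ U → q.ker ≤ U →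
        (∀ z ∈ lcSeries K (FreeLieTwo K) k, z ∈ U → raising K z ∈ U) →
        (∀ z ∈ lcSeries K (FreeLieTwo K) k, z ∈ U → lowering K z ∈ U) →
        ∀ p ∈ q.ker, p ∈ lcSeries K (FreeLieTwo K) k → p ∉ lcSeries K (FreeLieTwo K) (k + 1) →
          lcSeries K (FreeLieTwo K) k ≤ U) → q.ker ≤ lcSeries K (FreeLieTwo K) (k + 1) := by
    intro k hk hle hirr p hp
    by_contra hpk
    have hU := hirr (q.ker ⊔ lcSeries K (FreeLieTwo K) (k + 1)) le_sup_right le_sup_left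
      (fun z hz hzU => hx.matrixDerivation_mem hq hz hzU)
      (fun z hz hzU => hy.matrixDerivation_mem hq hz hzU) p hp (hle hp) hpk
    exact ht' ((lcSeries_anti (by omega)).trans (lcSeries_le_of_le_sup hU ht))
  have h1 : 2 ≤ t → q.ker ≤ lcSeries K (FreeLieTwo K) 2 := fun h =>
    step 1 h hker fun U hU hIU _ _ p hp hp1 hp2 => lcSeries_one_le_of_not_le hU hIU hp hp1 hp2
  have h2 : 3 ≤ t → q.ker ≤ lcSeries K (FreeLieTwo K) 3 := fun h =>
    step 2 h (h1 (by omega)) fun U hU hIU hr hl p hp hp1 hp2 =>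
      lcSeries_two_le_of_not_le hU hIU hr hl hp hp1 hp2
  have h3 : 4 ≤ t → q.ker ≤ lcSeries K (FreeLieTwo K) 4 := fun h =>
    step 3 h (h2 (by omega)) fun U hU hIU hr hl p hp hp1 hp2 =>
      lcSeries_three_le_of_not_le hU hIU hr hl hp hp1 hp2
  interval_cases t
  · intro p _; exact mem_lcSeries_zero p
  · exact hker
  · exact h1 le_rfl
  · exact h2 le_rfl
  · exact h3 le_rfl

namespace FreeNilpotentTwo

theorem not_admitsNontrivialLeviExtension {t : ℕ} (ht4 : t ≤ 4)
    {J : LieIdeal K (FreeNilpotentTwo K t)}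
    (hJ1 : J ≤ lcSeries K (FreeNilpotentTwo K t) 1)
    (hJ2 : ¬ lcSeries K (FreeNilpotentTwo K t) (t - 1) ≤ J) (hJ : J ≠ ⊥) (ht1 : 1 ≤ t) :
    ¬ AdmitsNontrivialLeviExtension K (FreeNilpotentTwo K t ⧸ J) := by
  intro h
  obtain ⟨R, S, _, _, _, _, e, ρ, hS, hρ⟩ := h.exists_action
  let q : FreeLieTwo K →ₗ⁅K⁆ R := (e : _ →ₗ⁅K⁆ R).comp (J.quotHom.comp (proj K t))
  have hq : Function.Surjective q :=
    e.surjective.comp (J.quotHom_surjective.comp (proj_surjective K t))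
  have hqker : ∀ x, x ∈ q.ker ↔ proj K t x ∈ J := fun x => by
    rw [LieHom.mem_ker, ← J.quotHom_eq_zero_iff]
    exact map_eq_zero_iff e.toLinearEquiv e.injective
  refine hJ ((LieSubmodule.eq_bot_iff _).2 fun y hy => ?_)
  obtain ⟨x, rfl⟩ := proj_surjective K t y
  refine proj_eq_zero_iff.2 (ker_le_lcSeries_of_action hq (fun x hx => ?_) ht4 (fun x hx => ?_)
    (fun hle => hJ2 fun y hy => ?_) hS ρ hρ ((hqker x).2 hy))
  · exact (proj_mem_lcSeries_iff ht1).1 (hJ1 ((hqker x).1 hx))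
  · rw [hqker, proj_eq_zero_iff.2 hx]
    exact zero_mem _
  · obtain ⟨x, hx, rfl⟩ := (mem_lcSeries_iff_of_surjective (proj_surjective K t) _ y).1 hy
    exact (hqker x).1 (hle hx)

end FreeNilpotentTwo

end NoLeviExtension

/-! ### Assembling the classification -/

namespace FreeNilpotentTwo

variable {K : Type u} [Field K] {L : Type v} [LieRing L] [LieAlgebra K L] {t : ℕ}

theorem nonempty_equiv_of_ker_eq_bot {f : FreeNilpotentTwo K t →ₗ⁅K⁆ L}
    (hf : Function.Surjective f) (hker : f.ker = ⊥) : Nonempty (L ≃ₗ⁅K⁆ FreeNilpotentTwo K t) :=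
  ⟨(LieEquiv.ofBijective f ⟨(LieHom.ker_eq_bot f).1 hker, hf⟩).symm⟩

theorem hasLieType_and_isNilpotentOfNilindex_of_equiv (ht1 : 1 ≤ t) (ht4 : t ≤ 4)
    {J : LieIdeal K (FreeNilpotentTwo K t)} (hJ1 : J ≤ lcSeries K (FreeNilpotentTwo K t) 1)
    (hJ2 : ¬ lcSeries K (FreeNilpotentTwo K t) (t - 1) ≤ J)
    (e : L ≃ₗ⁅K⁆ FreeNilpotentTwo K t ⧸ J) :
    HasLieType K L 2 ∧ IsNilpotentOfNilindex K L t := by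
  let f : FreeNilpotentTwo K t →ₗ⁅K⁆ L := (e.symm : _ →ₗ⁅K⁆ L).comp J.quotHom
  have hf : Function.Surjective f := e.symm.surjective.comp J.quotHom_surjective
  have hker : f.ker = J := by
    ext x
    rw [LieHom.mem_ker, ← J.quotHom_eq_zero_iff]
    exact map_eq_zero_iff e.symm.toLinearEquiv e.symm.injective
  exact ⟨hasLieType_of_surjective ht1 ht4 hf (hker.le.trans hJ1),
    isNilpotentOfNilindex_of_surjective ht1 hf (hker ▸ hJ2)⟩

/-- The elements `v₀`, `w₀`, `z₀`, `x₀` witness the top degree for `t = 1, 2, 3, 4`. -/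
theorem not_lcSeries_le_bot (ht1 : 1 ≤ t) (ht4 : t ≤ 4) :
    ¬ lcSeries K (FreeNilpotentTwo K t) (t - 1) ≤ ⊥ := by
  intro h
  have key : ∀ x ∈ lcSeries K (FreeNilpotentTwo K t) (t - 1), x = 0 := fun x hx =>
    (LieSubmodule.mem_bot x).1 (h hx)
  interval_cases t
  · have := eq_zero_of_smul_vv_mem (K := K) (t := 1) (α := 1) (β := 0) le_rfl
      (by rw [key (vv K 1 0) (mem_lcSeries_zero _)]; simp)
    simp at this
  · have := eq_zero_of_smul_ww_mem (K := K) (t := 2) (γ := 1) le_rfl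
      (by rw [key (ww K 2) ww_mem]; simp)
    simp at this
  · have := eq_zero_of_smul_zz_mem (K := K) (t := 3) (α := 1) (β := 0) le_rfl
      (by rw [key (zz K 3 0) (zz_mem 0)]; simp)
    simp at this
  · have := eq_zero_of_smul_xx_mem (K := K) (t := 4) (α := 1) (β := 0) (γ := 0) le_rfl
      (by rw [key (xx₀ K 4) xx_zero_mem]; simp)
    simp at this

theorem hasLieType_and_isNilpotentOfNilindex_of_equiv_free (ht1 : 1 ≤ t) (ht4 : t ≤ 4)
    (e : L ≃ₗ⁅K⁆ FreeNilpotentTwo K t) : HasLieType K L 2 ∧ IsNilpotentOfNilindex K L t := by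
  have hker : (e.symm : FreeNilpotentTwo K t →ₗ⁅K⁆ L).ker = ⊥ :=
    (LieHom.ker_eq_bot _).2 e.symm.injective
  exact ⟨hasLieType_of_surjective ht1 ht4 e.symm.surjective (hker.le.trans bot_le),
    isNilpotentOfNilindex_of_surjective ht1 e.symm.surjective
      (hker ▸ not_lcSeries_le_bot ht1 ht4)⟩

theorem IsListedThree.le_lcSeries_one {J : LieIdeal K (FreeNilpotentTwo K 3)}
    (hJ : IsListedThree K J.toSubmodule) : J ≤ lcSeries K (FreeNilpotentTwo K 3) 1 :=
  le_trans (show J ≤ lcSeries K (FreeNilpotentTwo K 3) 2 from hJ.1) (lcSeries_anti (by norm_num))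

theorem IsListedThree.ne_bot {J : LieIdeal K (FreeNilpotentTwo K 3)}
    (hJ : IsListedThree K J.toSubmodule) : J ≠ ⊥ := by
  rintro rfl
  have := hJ.2
  simp at this

theorem IsListedFour.le_lcSeries_one {J : LieIdeal K (FreeNilpotentTwo K 4)}
    (hJ : IsListedFour K J.toSubmodule) : J ≤ lcSeries K (FreeNilpotentTwo K 4) 1 :=
  le_trans (show J ≤ lcSeries K (FreeNilpotentTwo K 4) 2 from isListedFour_le hJ)
    (lcSeries_anti (by norm_num))

/-- The classification of the nilpotent Lie algebras of type `2` and nilindex at most `4`. -/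
theorem classification [CharZero K] :
    (HasLieType K L 2 ∧ ∃ t ≤ 4, IsNilpotentOfNilindex K L t) ↔
      ((∃ t : ℕ, 1 ≤ t ∧ t ≤ 4 ∧ Nonempty (L ≃ₗ⁅K⁆ FreeNilpotentTwo K t)) ∨
        (∃ J : LieIdeal K (FreeNilpotentTwo K 3), IsListedThree K J.toSubmodule ∧
          Nonempty (L ≃ₗ⁅K⁆ FreeNilpotentTwo K 3 ⧸ J)) ∨
        (∃ J : LieIdeal K (FreeNilpotentTwo K 4), IsListedFour K J.toSubmodule ∧
          Nonempty (L ≃ₗ⁅K⁆ FreeNilpotentTwo K 4 ⧸ J))) := by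
  constructor
  · rintro ⟨h2, t, ht4, ht⟩
    have ht1 : 1 ≤ t := ht.1
    obtain ⟨f, hf, hker1, hker2⟩ := exists_surjective_of_hasLieType h2 ht
    have hfree : f.ker = ⊥ → ∃ t : ℕ, 1 ≤ t ∧ t ≤ 4 ∧ Nonempty (L ≃ₗ⁅K⁆ FreeNilpotentTwo K t) :=
      fun h => ⟨t, ht1, ht4, nonempty_equiv_of_ker_eq_bot hf h⟩
    interval_cases t
    -- For `t = 1` and `t = 2` the kernel is already confined to `𝔫^(t+1) = 0`.
    · exact Or.inl (hfree (le_bot_iff.1 (hker1.trans lcSeries_eq_bot.le)))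
    · exact Or.inl (hfree (le_bot_iff.1
        ((le_lcSeries_two le_rfl hker1 hker2).trans lcSeries_eq_bot.le)))
    · exact (eq_bot_or_isListedThree hker1 hker2).imp hfree fun h =>
        Or.inl ⟨_, h, LieHom.nonempty_equiv_quotient_ker hf⟩
    · exact (eq_bot_or_isListedFour hker1 hker2).imp hfree fun h =>
        Or.inr ⟨_, h, LieHom.nonempty_equiv_quotient_ker hf⟩
  · rintro (⟨t, ht1, ht4, ⟨e⟩⟩ | ⟨J, hJ, ⟨e⟩⟩ | ⟨J, hJ, ⟨e⟩⟩)
    · have h := hasLieType_and_isNilpotentOfNilindex_of_equiv_free ht1 ht4 e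
      exact ⟨h.1, t, ht4, h.2⟩
    · have h := hasLieType_and_isNilpotentOfNilindex_of_equiv (by norm_num) (by norm_num)
        hJ.le_lcSeries_one (not_lcSeries_le_of_isListedThree hJ) e
      exact ⟨h.1, 3, by norm_num, h.2⟩
    · have h := hasLieType_and_isNilpotentOfNilindex_of_equiv (by norm_num) le_rfl
        hJ.le_lcSeries_one (not_lcSeries_le_of_isListedFour hJ) e
      exact ⟨h.1, 4, le_rfl, h.2⟩

end FreeNilpotentTwo

theorem mainTheorem4 (K : Type u) [Field K] [CharZero K] :
    -- the third and fourth powers are spanned by the `z`'s and the `x`'s respectively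
    ((lowerCentralPower K (FreeNilpotentTwo K 3) 3).toSubmodule =
        Submodule.span K {FreeNilpotentTwo.zz K 3 0, FreeNilpotentTwo.zz K 3 1} ∧
      (lowerCentralPower K (FreeNilpotentTwo K 4) 4).toSubmodule =
        Submodule.span K
          {FreeNilpotentTwo.xx₀ K 4, FreeNilpotentTwo.xx₁ K 4, FreeNilpotentTwo.xx₂ K 4}) ∧
    -- all listed subspaces are ideals
    ((∀ I : Submodule K (FreeNilpotentTwo K 3), FreeNilpotentTwo.IsListedThree K I →
        ∃ J : LieIdeal K (FreeNilpotentTwo K 3), J.toSubmodule = I) ∧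
      (∀ I : Submodule K (FreeNilpotentTwo K 4), FreeNilpotentTwo.IsListedFour K I →
        ∃ J : LieIdeal K (FreeNilpotentTwo K 4), J.toSubmodule = I)) ∧
    -- the classification
    (∀ (L : Type v) [LieRing L] [LieAlgebra K L],
      (HasLieType K L 2 ∧ ∃ t ≤ 4, IsNilpotentOfNilindex K L t) ↔
        ((∃ t : ℕ, 1 ≤ t ∧ t ≤ 4 ∧ Nonempty (L ≃ₗ⁅K⁆ FreeNilpotentTwo K t)) ∨
          (∃ J : LieIdeal K (FreeNilpotentTwo K 3),
            FreeNilpotentTwo.IsListedThree K J.toSubmodule ∧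
              Nonempty (L ≃ₗ⁅K⁆ FreeNilpotentTwo K 3 ⧸ J)) ∨
          (∃ J : LieIdeal K (FreeNilpotentTwo K 4),
            FreeNilpotentTwo.IsListedFour K J.toSubmodule ∧
              Nonempty (L ≃ₗ⁅K⁆ FreeNilpotentTwo K 4 ⧸ J)))) ∧
    -- nontrivial Levi extensions exist exactly for the free ones in the list
    ((∀ t : ℕ, 1 ≤ t → t ≤ 4 → AdmitsNontrivialLeviExtension K (FreeNilpotentTwo K t)) ∧
      (∀ J : LieIdeal K (FreeNilpotentTwo K 3), FreeNilpotentTwo.IsListedThree K J.toSubmodule →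
        ¬ AdmitsNontrivialLeviExtension K (FreeNilpotentTwo K 3 ⧸ J)) ∧
      (∀ J : LieIdeal K (FreeNilpotentTwo K 4), FreeNilpotentTwo.IsListedFour K J.toSubmodule →
        ¬ AdmitsNontrivialLeviExtension K (FreeNilpotentTwo K 4 ⧸ J))) :=
  ⟨⟨FreeNilpotentTwo.lcSeries_three_two_eq_span, FreeNilpotentTwo.lcSeries_four_three_eq_span⟩,
    ⟨fun _ hI => FreeNilpotentTwo.exists_lieIdeal_of_isListedThree hI,
      fun _ hI => FreeNilpotentTwo.exists_lieIdeal_of_isListedFour hI⟩,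
    fun _ _ _ => FreeNilpotentTwo.classification,
    fun _ ht1 ht4 => FreeNilpotentTwo.admitsNontrivialLeviExtension ht1 ht4,
    fun _ hJ => FreeNilpotentTwo.not_admitsNontrivialLeviExtension (by norm_num)
      hJ.le_lcSeries_one (FreeNilpotentTwo.not_lcSeries_le_of_isListedThree hJ) hJ.ne_bot
      (by norm_num),
    fun _ hJ => FreeNilpotentTwo.not_admitsNontrivialLeviExtension le_rfl
      hJ.le_lcSeries_one (FreeNilpotentTwo.not_lcSeries_le_of_isListedFour hJ)
      (fun h => FreeNilpotentTwo.isListedFour_ne_bot hJ (by rw [h, LieSubmodule.bot_toSubmodule]))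
      (by norm_num)⟩
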